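/- Let $d\ge 1$, $p\in(0,1)$, and let $m=m_t$, $n=n_t$ be sample sizes with $m+n=t$ and $m/t\to p$ as $t\to\infty$. For each $t$ observe two independent samples, $X_1,\dots,X_m$ IID with density $f$ and $Y_1,\dots,Y_n$ IID with density $g$ (with respect to Lebesgue measure on $\mathbb{R}^d$), and let $\mathbf{Z}=(Z_1,\dots,Z_t)=(X_1,\dots,X_m,Y_1,\dots,Y_n)$ be the combined sample. A matching of $[t]$ is a permutation $\sigma$ of $[t]$ with $\sigma(\sigma(k))=k$ for all $k$ and at most one fixed point. A matching rule $\mathcal{G}$ is a (measurable) function of the unordered set of sample points, possibly using auxiliary randomness independent of the samples to choose among several solutions, which returns a matching $\sigma$; its graph has an edge $Z_k\to Z_{\sigma(k)}$ for each $k$ with $\sigma(k)\neq k$, and $$\chi_{\mathcal{G}}=\#\{(i,j): i\le m<j,\ Z_i\to Z_j\}+\#\{(i,j): i\le m<j,\ Z_j\to Z_i\}.$$ Let $(\eta_t)$ be real numbers with $\eta_t\to 0$ and $\sqrt{t}\,\eta_t\to\infty$, and consider the test of $H_0:f=g$ that rejects when $\chi_{\mathcal{G}}/t<2p(1-p)-\eta_t$.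 (1) Let $\mathcal{G}$ return a matching that minimizes $\sum_{k=1}^t\lambda(\|Z_k-Z_{\sigma(k)}\|)$ over all matchings $\sigma$, where $\lambda:[0,\infty)\to\mathbb{R}$ is non-decreasing and $\lambda(b)\asymp b^\alpha$ as $b\downarrow 0$ for some $\alpha\in(0,d)$. Then the test is consistent against every fixed alternative: for all densities $f,g$ that do not agree almost everywhere, the probability of rejection tends to $1$. If moreover $\limsup_{t\to\infty}\bigl(2p(1-p)-2\tfrac{m}{t}\tfrac{n}{t}\bigr)/\eta_t<1$ (for example if $m/t-p=o(\eta_t)$, and in particular if $m/t-p=O(1/\sqrt t)$), then the test has asymptotic size $0$: the supremum, over all densities $f=g$, of the probability of rejection tends to $0$. (2) The same holds if $\mathcal{G}$ is the greedy matching (match a closest pair of points in Euclidean distance, remove it, and repeat until at most one point is left), with the densities $f,g$ restricted to those of distributions with compact support. -/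

import Mathlib

open Filter Topology MeasureTheory Asymptotics

namespace CrossMatch

/-- The observation space `ℝ^d` with its Euclidean norm. -/
abbrev Pt (d : ℕ) : Type := EuclideanSpace ℝ (Fin d)

/-- Probability densities on `ℝ^d` with respect to Lebesgue measure. -/
structure IsDensity {d : ℕ} (f : Pt d → ℝ) : Prop where
  measurable : Measurable f
  nonneg : ∀ x, 0 ≤ f x
  lintegral_eq_one : ∫⁻ x, ENNReal.ofReal (f x) = 1

/-- The distribution on `ℝ^d` with density `f`. -/
noncomputable def law {d : ℕ} (f : Pt d → ℝ) : Measure (Pt d) :=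
  volume.withDensity fun x => ENNReal.ofReal (f x)

/-- The distribution with density `f` has compact support. -/
def HasCompactLaw {d : ℕ} (f : Pt d → ℝ) : Prop :=
  ∃ K : Set (Pt d), IsCompact K ∧ law f Kᶜ = 0

/-- A matching of the index set `ι`: a permutation `σ` with `σ (σ k) = k` for all `k` and with at
most one fixed point. -/
structure IsMatching {ι : Type*} (σ : Equiv.Perm ι) : Prop where
  involutive : ∀ k, σ (σ k) = k
  fixed_subsingleton : {k | σ k = k}.Subsingleton

/-- The cost `∑ k, lam ‖z k - z (σ k)‖` of a matching of the points `z`. -/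
noncomputable def cost {d : ℕ} {ι : Type*} [Fintype ι] (lam : ℝ → ℝ) (z : ι → Pt d)
    (σ : Equiv.Perm ι) : ℝ :=
  ∑ k, lam ‖z k - z (σ k)‖

/-- `σ` is a matching of the points `z` of minimal cost among all matchings. -/
def IsOptimalMatching {d : ℕ} {ι : Type*} [Fintype ι] (lam : ℝ → ℝ) (z : ι → Pt d)
    (σ : Equiv.Perm ι) : Prop :=
  IsMatching σ ∧ ∀ τ : Equiv.Perm ι, IsMatching τ → cost lam z σ ≤ cost lam z τ

/-- `GreedyRun z R σ`: `σ` is a possible outcome of the greedy procedure started with the points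
`z k`, `k ∈ R`: match a closest pair, remove it, and repeat until at most one point is left. -/
inductive GreedyRun {d : ℕ} {ι : Type*} [DecidableEq ι] (z : ι → Pt d) :
    Finset ι → Equiv.Perm ι → Prop
  | base (R : Finset ι) (hR : R.card ≤ 1) : GreedyRun z R 1
  | step (R : Finset ι) (i j : ι) (σ : Equiv.Perm ι) (hi : i ∈ R) (hj : j ∈ R) (hij : i ≠ j)
      (closest : ∀ k ∈ R, ∀ l ∈ R, k ≠ l → ‖z i - z j‖ ≤ ‖z k - z l‖)
      (rest : GreedyRun z ((R.erase i).erase j) σ) :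
      GreedyRun z R (Equiv.swap i j * σ)

/-- `σ` is a greedy matching of the points `z`. -/
def IsGreedyMatching {d : ℕ} {ι : Type*} [Fintype ι] [DecidableEq ι] (z : ι → Pt d)
    (σ : Equiv.Perm ι) : Prop :=
  GreedyRun z Finset.univ σ

/-- A (possibly randomized) rule that chooses, for every finite set of distinct points, a
permutation pairing them. The set is given by an enumeration `z` and the permutation acts on the
indices; `unordered` says that the pairing of the points does not depend on the enumeration, i.e.
that the rule is a function of the unordered set. The parameter `u` is the auxiliary randomness
which may be used to choose among several solutions (a one-point `U` gives deterministic rules).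
The values at enumerations with repetitions are irrelevant. -/
structure MatchingRule (d : ℕ) (U : Type*) [MeasurableSpace U] where
  perm : ∀ t : ℕ, U → (Fin t → Pt d) → Equiv.Perm (Fin t)
  unordered : ∀ (t : ℕ) (u : U) (z : Fin t → Pt d) (π : Equiv.Perm (Fin t)),
    Function.Injective z → perm t u (z ∘ π) = π⁻¹ * perm t u z * π
  measurable : ∀ (t : ℕ) (i j : Fin t),
    MeasurableSet {w : U × (Fin t → Pt d) | perm t w.1 w.2 i = j}

/-- The rule solves the optimal matching problem with cost function `lam`. -/
def MatchingRule.IsOptimal {d : ℕ} {U : Type*} [MeasurableSpace U] (G : MatchingRule d U)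
    (lam : ℝ → ℝ) : Prop :=
  ∀ (t : ℕ) (u : U) (z : Fin t → Pt d), Function.Injective z →
    IsOptimalMatching lam z (G.perm t u z)

/-- The rule is the greedy matching, with some way of breaking ties. -/
def MatchingRule.IsGreedy {d : ℕ} {U : Type*} [MeasurableSpace U] (G : MatchingRule d U) : Prop :=
  ∀ (t : ℕ) (u : U) (z : Fin t → Pt d), Function.Injective z →
    IsGreedyMatching z (G.perm t u z)

/-- There is an edge from `i` to `j` in the graph of the matching `σ`. -/
def Edge {ι : Type*} (σ : Equiv.Perm ι) (i j : ι) : Prop :=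
  i ≠ j ∧ σ i = j

/-- The crossmatch statistic for a combined sample of `m` points (the first `m` indices) and `n`
points (the last `n` indices): the number of edges from the first sample to the second plus the
number of edges from the second sample to the first. -/
noncomputable def chi (m n : ℕ) (σ : Equiv.Perm (Fin (m + n))) : ℕ :=
  {q : Fin m × Fin n | Edge σ (Fin.castAdd n q.1) (Fin.natAdd m q.2)}.ncard +
    {q : Fin m × Fin n | Edge σ (Fin.natAdd m q.2) (Fin.castAdd n q.1)}.ncard

/-- The joint distribution of the auxiliary randomness and of the two samples: all independent,
`X_1, …, X_m` with density `f` and `Y_1, …, Y_n` with density `g`. -/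
noncomputable def sampleLaw {d : ℕ} {U : Type*} [MeasurableSpace U] (κ : Measure U) (m n : ℕ)
    (f g : Pt d → ℝ) : Measure (U × ((Fin m → Pt d) × (Fin n → Pt d))) :=
  κ.prod ((Measure.pi fun _ => law f).prod (Measure.pi fun _ => law g))

/-- The rejection region `χ / (m + n) < c`. -/
def rejectionRegion {d : ℕ} {U : Type*} [MeasurableSpace U] (G : MatchingRule d U) (m n : ℕ)
    (c : ℝ) : Set (U × ((Fin m → Pt d) × (Fin n → Pt d))) :=
  {w | (chi m n (G.perm (m + n) w.1 (Fin.append w.2.1 w.2.2)) : ℝ) / ((m + n : ℕ) : ℝ) < c}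

/-- The probability of rejection when the two samples have densities `f` and `g`. -/
noncomputable def rejectProb {d : ℕ} {U : Type*} [MeasurableSpace U] (κ : Measure U)
    (G : MatchingRule d U) (m n : ℕ) (c : ℝ) (f g : Pt d → ℝ) : ENNReal :=
  sampleLaw κ m n f g (rejectionRegion G m n c)

/-- The size of the test over the null hypothesis `f = g ∈ 𝓕`, for a class `𝓕` of densities: the
supremum of the probability of rejection over the null hypothesis. -/
noncomputable def size {d : ℕ} {U : Type*} [MeasurableSpace U] (κ : Measure U)
    (G : MatchingRule d U) (m n : ℕ) (c : ℝ) (𝓕 : Set (Pt d → ℝ)) : ENNReal :=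
  ⨆ f ∈ 𝓕, rejectProb κ G m n c f f

end CrossMatch

/-!
The statistic depends on the matching `σ` and on the set `A` of indices of the first sample only
through `crossCount A σ`, the number of indices `k` such that exactly one of `k`, `σ k` is in `A`.
A matching rule is a function of the unordered set of points, so the law of `χ` does not change if
the first sample is placed at any other set of `m` indices (`sampleLaw_chi_mem`), and one may
average over all of them.

*Size.* Under the null hypothesis this makes `χ` the cross count of a uniformly random `m`-subset
with a fixed matching. Inclusions of disjoint sets in a random subset are negatively correlated, so
the variance is `O(t)`, while the mean is at least `2 m n / t`. Chebyshev's inequality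
(`card_crossCount_lt_le`) bounds the probability of rejection by a constant over `t η²`, uniformly
in the density. Nothing is used of the rule except that it returns matchings.

*Consistency.* Let `φ = p f / (p f + (1 - p) g)`. Up to the probability that a binomial variable
equals `m`, which decays slower than any exponential (`exp_neg_le_choose_mul`), the sample can be
replaced by a sample `z` of size `t` from the mixture `p f + (1 - p) g` whose points receive
independent labels, with probability `φ (z k)` for the first sample. Given the points, `χ` satisfies
McDiarmid's inequality (`labelMean_exp_le`), and its mean is at most
`∑ 2 φ (z k) (1 - φ (z k)) + ∑ (φ (z k) - φ (z (σ k)))²`. The first sum is additive, with mean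
`2 t ∫ φ (1 - φ)`, which is smaller than `2 t p (1 - p)` by twice the variance of `φ`; this variance
is positive if `f ≠ g`. The second sum is dominated, up to a constant, by an additive functional
with mean at most `ε t` (`exists_sum_sq_le`), because matched points are mostly close to each other.
All estimates together form a single Chernoff bound (`choose_mul_sampleLaw_le`).

*Locality.* That matched points are close holds in a strong, deterministic form: in a bounded region
the number of edges longer than `ε` is bounded independently of `t`. Cut the region into finitely
many small cells. For an optimal matching, two long edges joining the same two cells could be
replaced by two short ones inside the cells. For the greedy matching, once a long edge is chosen all
remaining points are far apart, so each cell contains at most one of them. Thus neither moments nor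
compact supports are needed.
-/

open Filter Topology MeasureTheory Asymptotics

namespace CrossMatch

/-! ### The cross count of a matching and a set of labels -/

section Counting

variable {ι : Type*} [Fintype ι] [DecidableEq ι]

/-- The number of indices `k` such that exactly one of `k` and `σ k` lies in `A`. -/
def crossCount (A : Finset ι) (σ : Equiv.Perm ι) : ℕ :=
  (Finset.univ.filter fun k => ¬(k ∈ A ↔ σ k ∈ A)).card

/-- The indices of the first sample in the combined sample. -/
def firstSample (m n : ℕ) : Finset (Fin (m + n)) :=
  Finset.univ.map (Fin.castAddEmb n)

lemma castAdd_mem_firstSample (m n : ℕ) (i : Fin m) : Fin.castAdd n i ∈ firstSample m n := by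
  simp [firstSample]

lemma natAdd_notMem_firstSample (m n : ℕ) (j : Fin n) : Fin.natAdd m j ∉ firstSample m n := by
  simp only [firstSample, Finset.mem_map, Finset.mem_univ, true_and, not_exists]
  intro i h
  have := congrArg Fin.val h
  simp at this
  omega

lemma card_firstSample (m n : ℕ) : (firstSample m n).card = m := by
  simp [firstSample]

lemma chi_eq_crossCount (m n : ℕ) (σ : Equiv.Perm (Fin (m + n))) :
    chi m n σ = crossCount (firstSample m n) σ := by
  classical
  have h1 : {q : Fin m × Fin n | Edge σ (Fin.castAdd n q.1) (Fin.natAdd m q.2)}.ncard =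
      (Finset.univ.filter fun k => k ∈ firstSample m n ∧ σ k ∉ firstSample m n).card := by
    rw [← Set.ncard_coe_finset]
    rw [← Set.InjOn.ncard_image (f := fun q : Fin m × Fin n => Fin.castAdd n q.1)]
    · congr 1
      ext k
      simp only [Set.mem_image, Set.mem_ofPred_eq, Finset.coe_filter, Finset.mem_univ, true_and]
      constructor
      · rintro ⟨q, hq, rfl⟩
        exact ⟨castAdd_mem_firstSample _ _ _, by rw [hq.2]; exact natAdd_notMem_firstSample _ _ _⟩
      · rintro ⟨hk, hσ⟩
        induction k using Fin.addCases with
        | left i =>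
          generalize hl : σ (Fin.castAdd n i) = l at hσ
          induction l using Fin.addCases with
          | left j => exact absurd (castAdd_mem_firstSample m n j) hσ
          | right j =>
            refine ⟨(i, j), ⟨fun h => ?_, hl⟩, rfl⟩
            exact natAdd_notMem_firstSample m n j (h ▸ castAdd_mem_firstSample m n i)
        | right i => exact absurd hk (natAdd_notMem_firstSample _ _ _)
    · rintro ⟨a, b⟩ h ⟨a', b'⟩ h' e
      have e1 : a = a' := Fin.castAdd_injective m n e
      subst e1
      have := h.2.symm.trans h'.2
      exact Prod.ext rfl (Fin.natAdd_injective n m this)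
  have h2 : {q : Fin m × Fin n | Edge σ (Fin.natAdd m q.2) (Fin.castAdd n q.1)}.ncard =
      (Finset.univ.filter fun k => k ∉ firstSample m n ∧ σ k ∈ firstSample m n).card := by
    rw [← Set.ncard_coe_finset]
    rw [← Set.InjOn.ncard_image (f := fun q : Fin m × Fin n => Fin.natAdd m q.2)]
    · congr 1
      ext k
      simp only [Set.mem_image, Set.mem_ofPred_eq, Finset.coe_filter, Finset.mem_univ, true_and]
      constructor
      · rintro ⟨q, hq, rfl⟩
        exact ⟨natAdd_notMem_firstSample _ _ _, by rw [hq.2]; exact castAdd_mem_firstSample _ _ _⟩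
      · rintro ⟨hk, hσ⟩
        induction k using Fin.addCases with
        | right i =>
          generalize hl : σ (Fin.natAdd m i) = l at hσ
          induction l using Fin.addCases with
          | right j => exact absurd hσ (natAdd_notMem_firstSample m n j)
          | left j =>
            refine ⟨(j, i), ⟨fun h => ?_, hl⟩, rfl⟩
            exact natAdd_notMem_firstSample m n i (h ▸ castAdd_mem_firstSample m n j)
        | left i => exact absurd (castAdd_mem_firstSample _ _ _) hk
    · rintro ⟨a, b⟩ h ⟨a', b'⟩ h' e
      have e1 : b = b' := Fin.natAdd_injective n m e
      subst e1
      have := h.2.symm.trans h'.2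
      exact Prod.ext (Fin.castAdd_injective m n this) rfl
  rw [chi, h1, h2, crossCount, ← Finset.card_union_of_disjoint]
  · congr 1
    ext k
    simp only [Finset.mem_union, Finset.mem_filter, Finset.mem_univ, true_and]
    tauto
  · rw [Finset.disjoint_filter]
    tauto

/-- Relabelling the points by `π` moves a label set `A` to `π '' A`. -/
lemma crossCount_conj (A B : Finset ι) (σ π : Equiv.Perm ι) (h : ∀ k, π k ∈ B ↔ k ∈ A) :
    crossCount A (π⁻¹ * σ * π) = crossCount B σ := by
  unfold crossCount
  refine Finset.card_equiv π fun k => ?_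
  have h2 : (π⁻¹ * σ * π) k ∈ A ↔ σ (π k) ∈ B := by
    rw [← h]; simp [Equiv.Perm.mul_apply]
  simp only [Finset.mem_filter, Finset.mem_univ, true_and, h, h2]

lemma crossCount_eq (A : Finset ι) (σ : Equiv.Perm ι) :
    (crossCount A σ : ℝ) =
      2 * A.card - 2 * ∑ k, (if k ∈ A ∧ σ k ∈ A then (1 : ℝ) else 0) := by
  have h1 : (crossCount A σ : ℝ) = ∑ k, (if ¬(k ∈ A ↔ σ k ∈ A) then (1 : ℝ) else 0) := by
    rw [crossCount, Finset.card_filter]; push_cast; rfl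
  have h2 : (A.card : ℝ) = ∑ k, (if k ∈ A then (1 : ℝ) else 0) := by simp
  have h3 : (A.card : ℝ) = ∑ k, (if σ k ∈ A then (1 : ℝ) else 0) := by
    rw [h2]; exact (Equiv.sum_comp σ fun k => if k ∈ A then (1 : ℝ) else 0).symm
  have : (2 : ℝ) * A.card = ∑ k, (if k ∈ A then (1 : ℝ) else 0) +
      ∑ k, (if σ k ∈ A then (1 : ℝ) else 0) := by rw [← h2, ← h3]; ring
  rw [this, h1, Finset.mul_sum, ← Finset.sum_add_distrib, ← Finset.sum_sub_distrib]
  refine Finset.sum_congr rfl fun k _ => ?_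
  by_cases a : k ∈ A <;> by_cases b : σ k ∈ A <;> (simp [a, b]; try norm_num)

end Counting

/-! ### Random subsets of fixed size -/

section Inclusion

variable {ι : Type*} [Fintype ι] [DecidableEq ι]

/-- The probability that a uniformly random `m`-subset of an `N`-set contains `s` given elements. -/
noncomputable def inclProb (N m s : ℕ) : ℝ := (m.descFactorial s : ℝ) / N.descFactorial s

lemma inclProb_nonneg (N m s : ℕ) : 0 ≤ inclProb N m s := by unfold inclProb; positivity

lemma card_filter_subset (S : Finset ι) (m : ℕ) :
    (((Finset.univ.powersetCard m).filter fun A : Finset ι => S ⊆ A).card : ℝ) =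
      (Fintype.card ι).choose m * inclProb (Fintype.card ι) m S.card := by
  have hS : S.card ≤ Fintype.card ι := Finset.card_le_univ S
  have hpos : 0 < (Fintype.card ι).descFactorial S.card := Nat.descFactorial_pos.2 hS
  rw [inclProb, mul_div_assoc', eq_div_iff (by positivity)]
  norm_cast
  rcases le_or_gt S.card m with h | h
  · have : ((Finset.univ.powersetCard m).filter fun A : Finset ι => S ⊆ A).card =
        (Fintype.card ι - S.card).choose (m - S.card) := by
      rw [← Finset.card_compl, ← Finset.card_powersetCard]
      refine Finset.card_nbij' (fun A => A \ S) (fun B => B ∪ S) ?_ ?_ ?_ ?_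
      · intro A hA
        simp only [Finset.coe_filter, Finset.mem_powersetCard, Finset.subset_univ, true_and,
          Set.mem_ofPred_eq] at hA
        simp only [Finset.mem_coe, Finset.mem_powersetCard] at *
        refine ⟨fun x hx => ?_, ?_⟩
        · simp only [Finset.mem_sdiff] at hx; simpa using hx.2
        · rw [Finset.card_sdiff_of_subset hA.2, hA.1]
      · intro B hB
        simp only [Finset.mem_coe, Finset.mem_powersetCard] at hB
        have hd : Disjoint B S := by
          rw [Finset.disjoint_left]; intro x hx; simpa using hB.1 hx
        simp only [Finset.coe_filter, Finset.mem_powersetCard, Finset.subset_univ, true_and,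
          Set.mem_ofPred_eq, Finset.subset_union_right, and_true]
        rw [Finset.card_union_of_disjoint hd, hB.2]; omega
      · intro A hA
        simp only [Finset.coe_filter, Set.mem_ofPred_eq] at hA
        exact Finset.sdiff_union_of_subset hA.2
      · intro B hB
        simp only [Finset.mem_coe, Finset.mem_powersetCard] at hB
        have hd : Disjoint B S := by
          rw [Finset.disjoint_left]; intro x hx; simpa using hB.1 hx
        exact Finset.union_sdiff_cancel_right hd
    rw [this, Nat.descFactorial_eq_factorial_mul_choose, Nat.descFactorial_eq_factorial_mul_choose]
    have := Nat.choose_mul (n := Fintype.card ι) h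
    calc _ = S.card.factorial * ((Fintype.card ι).choose S.card *
          (Fintype.card ι - S.card).choose (m - S.card)) := by ring
      _ = _ := by rw [← this]; ring
  · rw [Nat.descFactorial_eq_zero_iff_lt.2 h, mul_zero, Nat.mul_eq_zero]
    left
    rw [Finset.card_eq_zero, Finset.filter_eq_empty_iff]
    intro A hA hSA
    rw [Finset.mem_powersetCard] at hA
    have := Finset.card_le_card hSA
    omega

lemma inclProb_succ (N m s : ℕ) : inclProb N m (s + 1) =
    inclProb N m s * (((m - s : ℕ) : ℝ) / ((N - s : ℕ) : ℝ)) := by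
  simp only [inclProb, Nat.descFactorial_succ]
  push_cast
  rw [div_mul_div_comm, mul_comm ((m - s : ℕ) : ℝ), mul_comm ((N - s : ℕ) : ℝ)]

/-- Negative correlation of the indicators that disjoint sets are contained in a random set. -/
lemma inclProb_add_le (N m s u : ℕ) (hm : m ≤ N) (h : s + u ≤ N) :
    inclProb N m (s + u) ≤ inclProb N m s * inclProb N m u := by
  induction u with
  | zero => simp [inclProb]
  | succ u ih =>
    rw [← add_assoc, inclProb_succ, inclProb_succ, ← mul_assoc]
    refine mul_le_mul (ih (by omega)) ?_ (by positivity)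
      (mul_nonneg (inclProb_nonneg _ _ _) (inclProb_nonneg _ _ _))
    rcases le_or_gt m (s + u) with h1 | h1
    · rw [Nat.sub_eq_zero_of_le h1]; simp; positivity
    · have e1 : 0 < N - (s + u) := by omega
      have e2 : 0 < N - u := by omega
      rw [div_le_div_iff₀ (by exact_mod_cast e1) (by exact_mod_cast e2)]
      rw [Nat.cast_sub (by omega), Nat.cast_sub (by omega), Nat.cast_sub (by omega),
        Nat.cast_sub (by omega)]
      push_cast
      have e3 : (m : ℝ) ≤ N := by exact_mod_cast hm
      nlinarith [mul_nonneg (Nat.cast_nonneg (α := ℝ) s) (sub_nonneg.2 e3)]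

lemma inclProb_le_one (N m s : ℕ) (hm : m ≤ N) : inclProb N m s ≤ 1 := by
  induction s with
  | zero => simp [inclProb]
  | succ s ih =>
    rw [inclProb_succ]
    refine mul_le_one₀ ih (by positivity) ?_
    exact div_le_one_of_le₀ (by exact_mod_cast Nat.sub_le_sub_right hm s) (by positivity)

/-- Twice the number of pairs of the matching inside `A` (plus one if the unmatched index is
in `A`). -/
noncomputable def innerSum (σ : Equiv.Perm ι) (A : Finset ι) : ℝ :=
  ∑ k, (if k ∈ A ∧ σ k ∈ A then (1 : ℝ) else 0)

/-- The expectation of `innerSum σ` for a uniformly random `m`-subset. -/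
noncomputable def innerMean (σ : Equiv.Perm ι) (m : ℕ) : ℝ :=
  ∑ k, inclProb (Fintype.card ι) m ({k, σ k} : Finset ι).card

lemma sum_innerSum (σ : Equiv.Perm ι) (m : ℕ) :
    ∑ A ∈ Finset.univ.powersetCard m, innerSum σ A =
      (Fintype.card ι).choose m * innerMean σ m := by
  unfold innerSum innerMean
  rw [Finset.sum_comm, Finset.mul_sum]
  refine Finset.sum_congr rfl fun k _ => ?_
  rw [← card_filter_subset, ← Finset.sum_filter, Finset.sum_const, nsmul_eq_mul, mul_one]
  simp [Finset.insert_subset_iff]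

lemma sum_innerSum_sq_le {σ : Equiv.Perm ι} (hσ : IsMatching σ) {m : ℕ}
    (hm : m ≤ Fintype.card ι) :
    ∑ A ∈ Finset.univ.powersetCard m, (innerSum σ A) ^ 2 ≤
      (Fintype.card ι).choose m * (innerMean σ m ^ 2 + 2 * Fintype.card ι) := by
  have h1 : ∀ A : Finset ι, (innerSum σ A) ^ 2 =
      ∑ k, ∑ l, if ({k, σ k} ∪ {l, σ l} : Finset ι) ⊆ A then (1 : ℝ) else 0 := by
    intro A
    rw [sq, innerSum, Finset.sum_mul_sum]
    refine Finset.sum_congr rfl fun k _ => Finset.sum_congr rfl fun l _ => ?_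
    rw [ite_zero_mul_ite_zero, mul_one]
    simp only [Finset.union_subset_iff, Finset.insert_subset_iff, Finset.singleton_subset_iff]
  have h2 : ∀ k, ∑ l, inclProb (Fintype.card ι) m ({k, σ k} ∪ {l, σ l} : Finset ι).card ≤
      inclProb (Fintype.card ι) m ({k, σ k} : Finset ι).card * innerMean σ m + 2 := by
    intro k
    have h3 : ∀ l, inclProb (Fintype.card ι) m ({k, σ k} ∪ {l, σ l} : Finset ι).card ≤
        inclProb (Fintype.card ι) m ({k, σ k} : Finset ι).card *
          inclProb (Fintype.card ι) m ({l, σ l} : Finset ι).card +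
          (if l ∈ ({k, σ k} : Finset ι) then 1 else 0) := by
      intro l
      split_ifs with hl
      · have := inclProb_le_one (Fintype.card ι) m ({k, σ k} ∪ {l, σ l} : Finset ι).card hm
        have := mul_nonneg (inclProb_nonneg (Fintype.card ι) m ({k, σ k} : Finset ι).card)
          (inclProb_nonneg (Fintype.card ι) m ({l, σ l} : Finset ι).card)
        linarith
      · have hd : Disjoint ({k, σ k} : Finset ι) {l, σ l} := by
          simp only [Finset.mem_insert, Finset.mem_singleton, not_or] at hl
          rw [Finset.disjoint_left]
          intro x hx hx'
          simp only [Finset.mem_insert, Finset.mem_singleton] at hx hx'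
          have i1 := hσ.involutive k
          have i2 := hσ.involutive l
          rcases hx with rfl | rfl <;> rcases hx' with h | h
          · exact hl.1 h.symm
          · exact hl.2 (by rw [h, i2])
          · exact hl.2 h.symm
          · exact hl.1 (σ.injective h).symm
        rw [Finset.card_union_of_disjoint hd, add_zero]
        refine inclProb_add_le _ _ _ _ hm ?_
        rw [← Finset.card_union_of_disjoint hd]
        exact Finset.card_le_univ _
    refine (Finset.sum_le_sum fun l _ => h3 l).trans ?_
    rw [Finset.sum_add_distrib, ← Finset.mul_sum]
    refine add_le_add le_rfl ?_
    rw [Finset.sum_ite_mem, Finset.univ_inter, Finset.sum_const, nsmul_eq_mul, mul_one]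
    exact_mod_cast Finset.card_le_two
  simp_rw [h1]
  rw [Finset.sum_comm]
  simp_rw [Finset.sum_comm (s := Finset.univ.powersetCard m)]
  simp_rw [← Finset.sum_filter, Finset.sum_const, nsmul_eq_mul, mul_one, card_filter_subset,
    ← Finset.mul_sum]
  refine mul_le_mul_of_nonneg_left ?_ (by positivity)
  refine (Finset.sum_le_sum fun k _ => h2 k).trans ?_
  rw [Finset.sum_add_distrib, ← Finset.sum_mul]
  simp only [Finset.sum_const, nsmul_eq_mul, Finset.card_univ]
  rw [← innerMean, sq]
  linarith

/-- The mean is at most `m² / N`; equality holds when there is an unmatched index. -/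
lemma innerMean_le {σ : Equiv.Perm ι} (hσ : IsMatching σ) {m : ℕ}
    (hm : m ≤ Fintype.card ι) (hN : 2 ≤ Fintype.card ι) :
    innerMean σ m ≤ (m : ℝ) ^ 2 / Fintype.card ι := by
  set N := Fintype.card ι with hNdef
  have hN0 : (0 : ℝ) < N := by positivity
  have hN1 : (1 : ℝ) ≤ N - 1 := by
    have : (2 : ℝ) ≤ N := by exact_mod_cast hN
    linarith
  have hm' : (m : ℝ) ≤ N := by exact_mod_cast hm
  have p1 : inclProb N m 1 = m / N := by simp [inclProb]
  have p2 : inclProb N m 2 = m * (m - 1) / (N * (N - 1)) := by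
    rw [inclProb, Nat.cast_descFactorial_two, Nat.cast_descFactorial_two]
  have key : ∀ k, inclProb N m ({k, σ k} : Finset ι).card =
      m * (m - 1) / (N * (N - 1)) + (if σ k = k then 1 else 0) *
        (m / N - m * (m - 1) / (N * (N - 1))) := by
    intro k
    split_ifs with h
    · rw [h]; simp [p1]
    · rw [Finset.card_pair (Ne.symm h), p2]; ring
  have hfix : ∑ k, (if σ k = k then (1 : ℝ) else 0) ≤ 1 := by
    rw [← Finset.sum_filter, Finset.sum_const, nsmul_eq_mul, mul_one]
    norm_cast
    rw [Finset.card_le_one]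
    intro a ha b hb
    exact hσ.fixed_subsingleton (by simpa using ha) (by simpa using hb)
  have hdiff : 0 ≤ (m : ℝ) / N - m * (m - 1) / (N * (N - 1)) := by
    have : (m : ℝ) / N - m * (m - 1) / (N * (N - 1)) = m * (N - m) / (N * (N - 1)) := by
      have : (N : ℝ) - 1 ≠ 0 := by linarith
      field_simp; ring
    rw [this]
    have : 0 ≤ (N : ℝ) - m := by linarith
    have : 0 ≤ (N : ℝ) - 1 := by linarith
    positivity
  unfold innerMean
  rw [← hNdef, Finset.sum_congr rfl fun k _ => key k, Finset.sum_add_distrib, ← Finset.sum_mul,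
    Finset.sum_const, Finset.card_univ, ← hNdef, nsmul_eq_mul]
  have := mul_le_mul_of_nonneg_right hfix hdiff
  have e : (N : ℝ) * (m * (m - 1) / (N * (N - 1))) +
      1 * (m / N - m * (m - 1) / (N * (N - 1))) = m ^ 2 / N := by
    have : (N : ℝ) - 1 ≠ 0 := by linarith
    field_simp; ring
  linarith

/-- Chebyshev's inequality for the number of cross pairs under a uniformly random labelling. -/
lemma card_crossCount_lt_le {σ : Equiv.Perm ι} (hσ : IsMatching σ) {m : ℕ}
    (hm : m ≤ Fintype.card ι) (hN : 2 ≤ Fintype.card ι) {y : ℝ} (hy : 0 < y) :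
    (((Finset.univ.powersetCard m).filter fun A : Finset ι =>
        (crossCount A σ : ℝ) < 2 * m - 2 * m ^ 2 / Fintype.card ι - 2 * y).card : ℝ) ≤
      (Fintype.card ι).choose m * (2 * Fintype.card ι / y ^ 2) := by
  set N := Fintype.card ι
  have hv : ∑ A ∈ Finset.univ.powersetCard m, (innerSum σ A - innerMean σ m) ^ 2 ≤
      N.choose m * (2 * N) := by
    have h1 := sum_innerSum_sq_le hσ hm
    have h2 := sum_innerSum σ m
    have : ∑ A ∈ Finset.univ.powersetCard m, (innerSum σ A - innerMean σ m) ^ 2 =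
        ∑ A ∈ Finset.univ.powersetCard m, (innerSum σ A) ^ 2
          - 2 * innerMean σ m * ∑ A ∈ Finset.univ.powersetCard m, innerSum σ A
          + N.choose m * innerMean σ m ^ 2 := by
      have hc : ((N.choose m : ℕ) : ℝ) * innerMean σ m ^ 2 =
          ∑ A ∈ (Finset.univ : Finset ι).powersetCard m, innerMean σ m ^ 2 := by
        rw [Finset.sum_const, Finset.card_powersetCard, nsmul_eq_mul, Finset.card_univ]
      rw [hc, Finset.mul_sum, ← Finset.sum_sub_distrib, ← Finset.sum_add_distrib]
      refine Finset.sum_congr rfl fun A _ => by ring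
    rw [this, h2]
    nlinarith
  have hy2 : 0 < y ^ 2 := by positivity
  rw [mul_div_assoc', le_div_iff₀ hy2]
  refine le_trans ?_ hv
  rw [← nsmul_eq_mul, ← Finset.sum_const]
  refine (Finset.sum_le_sum fun A hA => ?_).trans
    (Finset.sum_le_sum_of_subset_of_nonneg (Finset.filter_subset _ _)
      fun A _ _ => sq_nonneg (innerSum σ A - innerMean σ m))
  simp only [Finset.mem_filter, Finset.mem_powersetCard, Finset.subset_univ, true_and] at hA
  have h1 := crossCount_eq A σ
  rw [hA.1] at h1
  have h2 := innerMean_le hσ hm hN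
  have h3 : y ≤ innerSum σ A - innerMean σ m := by
    have := hA.2
    rw [h1, mul_div_assoc] at this
    unfold innerSum
    linarith
  exact pow_le_pow_left₀ hy.le h3 2

end Inclusion

/-! ### Independent labels and bounded differences -/

section Bernoulli

variable {ι : Type*} [DecidableEq ι]

/-- The probability that independent Bernoulli variables with success probabilities `a k`, `k ∈ s`,
have `A` as their set of successes. -/
def labelWeight (a : ι → ℝ) (s A : Finset ι) : ℝ :=
  (∏ k ∈ A, a k) * ∏ k ∈ s \ A, (1 - a k)

/-- The expectation of `F` at the random set of successes of independent Bernoulli variables. -/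
def labelMean (a : ι → ℝ) (s : Finset ι) (F : Finset ι → ℝ) : ℝ :=
  ∑ A ∈ s.powerset, labelWeight a s A * F A

lemma labelWeight_nonneg {a : ι → ℝ} (ha : ∀ k, a k ∈ Set.Icc (0 : ℝ) 1) (s A : Finset ι) :
    0 ≤ labelWeight a s A :=
  mul_nonneg (Finset.prod_nonneg fun k _ => (ha k).1)
    (Finset.prod_nonneg fun k _ => sub_nonneg.2 (ha k).2)

lemma sum_labelWeight (a : ι → ℝ) (s : Finset ι) :
    ∑ A ∈ s.powerset, labelWeight a s A = 1 := by
  unfold labelWeight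
  rw [← Finset.prod_add]
  simp

lemma labelMean_insert (a : ι → ℝ) {s : Finset ι} {k : ι} (hk : k ∉ s) (F : Finset ι → ℝ) :
    labelMean a (insert k s) F =
      a k * labelMean a s (fun A => F (insert k A)) + (1 - a k) * labelMean a s F := by
  unfold labelMean
  rw [Finset.sum_powerset_insert hk, add_comm, Finset.mul_sum, Finset.mul_sum]
  congr 1
  · refine Finset.sum_congr rfl fun A hA => ?_
    rw [Finset.mem_powerset] at hA
    have hkA : k ∉ A := fun h => hk (hA h)
    have e : insert k s \ insert k A = s \ A := by
      ext x; simp only [Finset.mem_sdiff, Finset.mem_insert]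
      by_cases hx : x = k
      · subst hx; simp [hk]
      · simp [hx]
    rw [labelWeight, labelWeight, e, Finset.prod_insert hkA]; ring
  · refine Finset.sum_congr rfl fun A hA => ?_
    rw [Finset.mem_powerset] at hA
    have hkA : k ∉ A := fun h => hk (hA h)
    rw [labelWeight, labelWeight, Finset.insert_sdiff_of_notMem _ hkA,
      Finset.prod_insert (by simp [hk])]
    ring

/-- The case of a single Bernoulli variable in the bounded differences inequality, from
`exp u ≤ 1 + u + u ^ 2` for `|u| ≤ 1`. -/
lemma two_point_exp_le {a r x y c : ℝ} (ha : a ∈ Set.Icc (0 : ℝ) 1) (hr : 0 ≤ r)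
    (hrc : r * c ≤ 1) (hxy : |x - y| ≤ c) :
    a * Real.exp (r * x) + (1 - a) * Real.exp (r * y) ≤
      Real.exp (r * (a * x + (1 - a) * y) + (r * c) ^ 2) := by
  have hc : 0 ≤ c := (abs_nonneg _).trans hxy
  have ha0 := ha.1
  have ha1 : 0 ≤ 1 - a := sub_nonneg.2 ha.2
  have step : ∀ u : ℝ, |u| ≤ r * c → Real.exp u ≤ 1 + u + (r * c) ^ 2 := by
    intro u hu
    have h1 := (abs_le.1 (Real.abs_exp_sub_one_sub_id_le (hu.trans hrc))).2
    have h2 : u ^ 2 ≤ (r * c) ^ 2 := sq_le_sq' (abs_le.1 hu).1 (abs_le.1 hu).2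
    linarith
  have b1 : |r * ((1 - a) * (x - y))| ≤ r * c := by
    rw [abs_mul, abs_mul, abs_of_nonneg hr, abs_of_nonneg ha1]
    refine mul_le_mul_of_nonneg_left ?_ hr
    nlinarith [abs_nonneg (x - y)]
  have b2 : |r * (-a * (x - y))| ≤ r * c := by
    rw [abs_mul, abs_mul, abs_of_nonneg hr, abs_neg, abs_of_nonneg ha0]
    refine mul_le_mul_of_nonneg_left ?_ hr
    nlinarith [abs_nonneg (x - y), ha.2]
  have e1 : r * x = r * (a * x + (1 - a) * y) + r * ((1 - a) * (x - y)) := by ring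
  have e2 : r * y = r * (a * x + (1 - a) * y) + r * (-a * (x - y)) := by ring
  rw [e1, e2, Real.exp_add, Real.exp_add, Real.exp_add]
  have h := Real.add_one_le_exp ((r * c) ^ 2)
  have k1 := mul_le_mul_of_nonneg_left (step _ b1) ha0
  have k2 := mul_le_mul_of_nonneg_left (step _ b2) ha1
  calc _ = Real.exp (r * (a * x + (1 - a) * y)) * (a * Real.exp (r * ((1 - a) * (x - y))) +
        (1 - a) * Real.exp (r * (-a * (x - y)))) := by ring
    _ ≤ _ := by
      refine mul_le_mul_of_nonneg_left ?_ (Real.exp_pos _).le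
      linarith

lemma abs_labelMean_sub_le {a : ι → ℝ} (ha : ∀ k, a k ∈ Set.Icc (0 : ℝ) 1) (s : Finset ι)
    {F H : Finset ι → ℝ} {c : ℝ} (h : ∀ A, |F A - H A| ≤ c) :
    |labelMean a s F - labelMean a s H| ≤ c := by
  unfold labelMean
  rw [← Finset.sum_sub_distrib]
  refine (Finset.abs_sum_le_sum_abs _ _).trans ?_
  calc _ ≤ ∑ A ∈ s.powerset, labelWeight a s A * c := by
        refine Finset.sum_le_sum fun A _ => ?_
        rw [← mul_sub, abs_mul, abs_of_nonneg (labelWeight_nonneg ha s A)]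
        exact mul_le_mul_of_nonneg_left (h A) (labelWeight_nonneg ha s A)
    _ = c := by rw [← Finset.sum_mul, sum_labelWeight, one_mul]

/-- The bounded differences inequality of McDiarmid, for independent Bernoulli variables and small
exponents. -/
lemma labelMean_exp_le {a : ι → ℝ} (ha : ∀ k, a k ∈ Set.Icc (0 : ℝ) 1) {r c : ℝ} (hr : 0 ≤ r)
    (hrc : r * c ≤ 1) (s : Finset ι) (F : Finset ι → ℝ)
    (hF : ∀ k A, |F (insert k A) - F A| ≤ c) :
    labelMean a s (fun A => Real.exp (r * F A)) ≤
      Real.exp (r * labelMean a s F + s.card * (r * c) ^ 2) := by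
  induction s using Finset.induction_on generalizing F with
  | empty => simp [labelMean, labelWeight]
  | insert k s hk ih =>
    rw [labelMean_insert a hk, labelMean_insert a hk, Finset.card_insert_of_notMem hk]
    have i1 := ih (fun A => F (insert k A)) fun j A => by
      rw [Finset.insert_comm]; exact hF j (insert k A)
    have i2 := ih F hF
    have hd := abs_labelMean_sub_le ha s (hF k)
    have h2 := two_point_exp_le (ha k) hr hrc hd
    have ha0 := (ha k).1
    have ha1 : 0 ≤ 1 - a k := sub_nonneg.2 (ha k).2
    refine (add_le_add (mul_le_mul_of_nonneg_left i1 ha0)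
      (mul_le_mul_of_nonneg_left i2 ha1)).trans ?_
    rw [Real.exp_add, Real.exp_add]
    calc _ = (a k * Real.exp (r * labelMean a s fun A => F (insert k A)) +
          (1 - a k) * Real.exp (r * labelMean a s F)) * Real.exp (s.card * (r * c) ^ 2) := by ring
      _ ≤ _ := mul_le_mul_of_nonneg_right h2 (Real.exp_pos _).le
      _ = _ := by rw [← Real.exp_add]; congr 1; push_cast; ring

variable [Fintype ι]

lemma abs_crossCount_insert_sub_le (σ : Equiv.Perm ι) (k : ι) (A : Finset ι) :
    |(crossCount (insert k A) σ : ℝ) - crossCount A σ| ≤ 2 := by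
  have h : ∀ A : Finset ι, (crossCount A σ : ℝ) =
      ∑ j, (if ¬(j ∈ A ↔ σ j ∈ A) then (1 : ℝ) else 0) := by
    intro A; rw [crossCount, Finset.card_filter]; push_cast; rfl
  rw [h, h, ← Finset.sum_sub_distrib]
  refine (Finset.abs_sum_le_sum_abs _ _).trans ?_
  calc _ ≤ ∑ j, (if j ∈ ({k, σ.symm k} : Finset ι) then (1 : ℝ) else 0) := by
        refine Finset.sum_le_sum fun j _ => ?_
        by_cases hj : j ∈ ({k, σ.symm k} : Finset ι)
        · rw [if_pos hj]
          split_ifs <;> simp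
        · rw [if_neg hj]
          simp only [Finset.mem_insert, Finset.mem_singleton, not_or] at hj
          have h1 : σ j ≠ k := fun h => hj.2 (by rw [← h]; simp)
          simp [hj.1, h1]
    _ ≤ 2 := by
        rw [Finset.sum_ite_mem, Finset.univ_inter, Finset.sum_const, nsmul_eq_mul, mul_one]
        exact_mod_cast Finset.card_le_two

/-- Distinct labels are independent. -/
lemma labelMean_mem_notMem (a : ι → ℝ) {k l : ι} (hkl : k ≠ l) :
    labelMean a Finset.univ (fun A => if k ∈ A ∧ l ∉ A then 1 else 0) = a k * (1 - a l) := by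
  have h : ∀ A ∈ (Finset.univ : Finset ι).powerset,
      labelWeight a Finset.univ A * (if k ∈ A ∧ l ∉ A then (1 : ℝ) else 0) =
        (∏ i ∈ A, Function.update a l 0 i) *
          ∏ i ∈ Finset.univ \ A, Function.update (fun i => 1 - a i) k 0 i := by
    intro A _
    by_cases hl : l ∈ A
    · rw [Finset.prod_eq_zero hl (by simp)]; simp [hl]
    by_cases hk : k ∈ A
    · simp only [hk, hl, not_false_eq_true, and_self, if_true, mul_one, labelWeight]
      congr 1
      · refine Finset.prod_congr rfl fun i hi => ?_
        rw [Function.update_of_ne]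
        rintro rfl
        exact hl hi
      · refine Finset.prod_congr rfl fun i hi => ?_
        rw [Function.update_of_ne]
        rintro rfl
        simp [hk] at hi
    · have hk' : k ∈ Finset.univ \ A := by simp [hk]
      rw [Finset.prod_eq_zero hk' (by simp)]; simp [hk]
  rw [labelMean, Finset.sum_congr rfl h, ← Finset.prod_add]
  rw [Finset.prod_eq_mul k l hkl]
  · simp [hkl, hkl.symm]
  · rintro i _ ⟨h1, h2⟩
    simp [h1, h2]
  · simp
  · simp

/-- The mean of the cross count, from
`a (1 - b) + (1 - a) b = a (1 - a) + b (1 - b) + (a - b) ^ 2`. -/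
lemma labelMean_crossCount_le {a : ι → ℝ} (ha : ∀ k, a k ∈ Set.Icc (0 : ℝ) 1)
    (σ : Equiv.Perm ι) :
    labelMean a Finset.univ (fun A => (crossCount A σ : ℝ)) ≤
      ∑ k, 2 * (a k * (1 - a k)) + ∑ k, (a k - a (σ k)) ^ 2 := by
  have h : ∀ A : Finset ι, (crossCount A σ : ℝ) =
      ∑ j, ((if j ∈ A ∧ σ j ∉ A then (1 : ℝ) else 0) + if σ j ∈ A ∧ j ∉ A then 1 else 0) := by
    intro A
    rw [crossCount, Finset.card_filter]
    push_cast
    refine Finset.sum_congr rfl fun j _ => ?_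
    by_cases h1 : j ∈ A <;> by_cases h2 : σ j ∈ A <;> simp [h1, h2]
  have hlin : labelMean a Finset.univ (fun A => (crossCount A σ : ℝ)) =
      ∑ j, (labelMean a Finset.univ (fun A => if j ∈ A ∧ σ j ∉ A then (1 : ℝ) else 0) +
        labelMean a Finset.univ (fun A => if σ j ∈ A ∧ j ∉ A then (1 : ℝ) else 0)) := by
    simp only [labelMean, h, Finset.mul_sum, ← Finset.sum_add_distrib, mul_add]
    rw [Finset.sum_comm]
  rw [hlin]
  have hsum : ∑ k, 2 * (a k * (1 - a k)) =
      ∑ k, (a k * (1 - a k) + a (σ k) * (1 - a (σ k))) := by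
    rw [Finset.sum_add_distrib, Equiv.sum_comp σ fun k => a k * (1 - a k), ← Finset.sum_add_distrib]
    refine Finset.sum_congr rfl fun k _ => by ring
  rw [hsum, ← Finset.sum_add_distrib]
  refine Finset.sum_le_sum fun k _ => ?_
  by_cases hk : σ k = k
  · have h0 : labelMean a Finset.univ (fun A : Finset ι => if k ∈ A ∧ k ∉ A then (1 : ℝ) else 0)
        = 0 := by simp [labelMean]
    rw [hk, h0]
    have := mul_nonneg (ha k).1 (sub_nonneg.2 (ha k).2)
    nlinarith [sq_nonneg (a k - a k)]
  · rw [labelMean_mem_notMem a (Ne.symm hk), labelMean_mem_notMem a hk]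
    nlinarith

end Bernoulli

/-! ### Lower bounds for binomial probabilities -/

section Binomial

open Nat in
lemma factorial_mul_pow_le (m k : ℕ) : m ! * m ^ k ≤ k ! * m ^ m := by
  rcases le_total m k with h | h
  · have := Nat.factorial_mul_pow_sub_le_factorial h
    calc m ! * m ^ k = m ! * m ^ (k - m) * m ^ m := by
          rw [mul_assoc, ← pow_add, Nat.sub_add_cancel h]
      _ ≤ _ := Nat.mul_le_mul_right _ this
  · have h1 := Nat.factorial_mul_descFactorial (Nat.sub_le m k)
    rw [Nat.sub_sub_self h] at h1
    have h2 := Nat.descFactorial_le_pow m (m - k)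
    calc m ! * m ^ k = k ! * m.descFactorial (m - k) * m ^ k := by rw [h1]
      _ ≤ k ! * m ^ (m - k) * m ^ k := by gcongr
      _ = _ := by rw [mul_assoc, ← pow_add, Nat.sub_add_cancel h]

open Nat in
/-- The mode of the binomial distribution with parameters `m + n` and `m / (m + n)` is `m`; so its
probability is at least `1 / (m + n + 1)`. -/
lemma pow_self_le_choose_mul (m n : ℕ) :
    (m + n) ^ (m + n) ≤ (m + n + 1) * ((m + n).choose m * m ^ m * n ^ n) := by
  rw [add_pow]
  have : ∀ k ∈ Finset.range (m + n + 1), m ^ k * n ^ (m + n - k) * (m + n).choose k ≤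
      (m + n).choose m * m ^ m * n ^ n := by
    intro k hk
    have hk : k ≤ m + n := by simpa [Nat.lt_succ_iff] using hk
    obtain ⟨l, hl⟩ := Nat.exists_eq_add_of_le hk
    have hl' : m + n - k = l := by omega
    have hml : m + n - m = n := by omega
    rw [hl']
    have c1 := Nat.choose_mul_factorial_mul_factorial hk
    have c2 := Nat.choose_mul_factorial_mul_factorial (Nat.le_add_right m n)
    rw [hl'] at c1
    rw [hml] at c2
    refine Nat.le_of_mul_le_mul_right (c := k ! * l !) ?_
      (Nat.mul_pos (Nat.factorial_pos _) (Nat.factorial_pos _))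
    calc m ^ k * n ^ l * (m + n).choose k * (k ! * l !)
        = ((m + n).choose k * k ! * l !) * (m ^ k * n ^ l) := by ring
      _ = (m + n).choose m * ((m ! * m ^ k) * (n ! * n ^ l)) := by rw [c1, ← c2]; ring
      _ ≤ (m + n).choose m * ((k ! * m ^ m) * (l ! * n ^ n)) :=
          Nat.mul_le_mul_left _ (Nat.mul_le_mul (factorial_mul_pow_le m k)
            (factorial_mul_pow_le n l))
      _ = _ := by ring
  refine (Finset.sum_le_sum this).trans ?_
  simp

/-- The probability that a binomial variable with parameters `t` and `p` equals `m t ~ p t` does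
not decay exponentially. -/
lemma exp_neg_le_choose_mul {p : ℝ} (hp : p ∈ Set.Ioo (0 : ℝ) 1) {m n : ℕ → ℕ}
    (hmn : ∀ t, m t + n t = t)
    (hm : Tendsto (fun t : ℕ => (m t : ℝ) / (t : ℝ)) atTop (𝓝 p)) {δ : ℝ} (hδ : 0 < δ) :
    ∀ᶠ t : ℕ in atTop, Real.exp (-(δ * t)) ≤
      (t.choose (m t) : ℝ) * p ^ (m t) * (1 - p) ^ (n t) := by
  have hp0 := hp.1
  have hq0 : 0 < 1 - p := sub_pos.2 hp.2
  have hn : Tendsto (fun t : ℕ => (n t : ℝ) / (t : ℝ)) atTop (𝓝 (1 - p)) := by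
    refine (tendsto_const_nhds.sub hm).congr' ?_
    filter_upwards [eventually_gt_atTop 0] with t ht
    have : (t : ℝ) ≠ 0 := by positivity
    have h : (m t : ℝ) + n t = t := by exact_mod_cast hmn t
    field_simp
    linarith
  have he : 1 < Real.exp (δ / 2) := Real.one_lt_exp_iff.2 (by positivity)
  have e1 := hm.eventually_lt_const (show p < p * Real.exp (δ / 2) by nlinarith)
  have e2 := hn.eventually_lt_const (show 1 - p < (1 - p) * Real.exp (δ / 2) by nlinarith)
  have e3 : ∀ᶠ t : ℕ in atTop, (t : ℝ) + 1 ≤ Real.exp (δ / 2 * t) := by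
    have hδ2 : 0 < δ / 2 := by positivity
    filter_upwards [eventually_ge_atTop ⌈2 / (δ / 2) ^ 2⌉₊, eventually_gt_atTop 0] with t ht ht0
    have h1 : 2 / (δ / 2) ^ 2 ≤ (t : ℝ) := (Nat.le_ceil _).trans (by exact_mod_cast ht)
    rw [div_le_iff₀ (by positivity)] at h1
    have h2 := Real.quadratic_le_exp_of_nonneg (x := δ / 2 * t) (by positivity)
    have ht1 : (1 : ℝ) ≤ t := by exact_mod_cast ht0
    nlinarith [mul_nonneg hδ2.le (zero_le_one.trans ht1)]
  filter_upwards [e1, e2, e3, eventually_gt_atTop 0] with t h1 h2 h3 ht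
  have ht0 : (0 : ℝ) < t := by positivity
  rw [div_lt_iff₀ ht0] at h1 h2
  have hb := pow_self_le_choose_mul (m t) (n t)
  rw [hmn t] at hb
  have hb' : (t : ℝ) ^ t ≤ (t + 1) * (t.choose (m t) * (m t : ℝ) ^ m t * (n t : ℝ) ^ n t) := by
    exact_mod_cast hb
  have m1 : (m t : ℝ) ^ m t ≤ (p * Real.exp (δ / 2) * t) ^ m t :=
    pow_le_pow_left₀ (by positivity) h1.le _
  have m2 : (n t : ℝ) ^ n t ≤ ((1 - p) * Real.exp (δ / 2) * t) ^ n t :=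
    pow_le_pow_left₀ (by positivity) h2.le _
  have hexp : Real.exp (δ / 2) ^ t = Real.exp (δ / 2 * t) := by
    rw [← Real.exp_nat_mul]; congr 1; ring
  set Q := (t.choose (m t) : ℝ) * p ^ (m t) * (1 - p) ^ (n t) with hQ
  have hQ0 : 0 ≤ Q := by positivity
  have hfin : (t : ℝ) ^ t ≤ (t + 1) * (Q * Real.exp (δ / 2 * t)) * t ^ t := by
    calc (t : ℝ) ^ t ≤ (t + 1) * (t.choose (m t) * (m t : ℝ) ^ m t * (n t : ℝ) ^ n t) := hb'
      _ ≤ (t + 1) * (t.choose (m t) * (p * Real.exp (δ / 2) * t) ^ m t *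
            ((1 - p) * Real.exp (δ / 2) * t) ^ n t) := by gcongr
      _ = (t + 1) * (Q * (Real.exp (δ / 2) ^ (m t + n t))) * t ^ (m t + n t) := by
          rw [hQ, pow_add, pow_add, mul_pow, mul_pow, mul_pow, mul_pow]; ring
      _ = _ := by rw [hmn t, hexp]
  have hone : 1 ≤ (t + 1) * (Q * Real.exp (δ / 2 * t)) := by
    have : (0 : ℝ) < (t : ℝ) ^ t := by positivity
    exact le_of_mul_le_mul_right (by rw [one_mul]; exact hfin) this
  have hone' : 1 ≤ Q * Real.exp (δ * t) := by
    refine hone.trans ?_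
    have : Real.exp (δ * t) = Real.exp (δ / 2 * t) * Real.exp (δ / 2 * t) := by
      rw [← Real.exp_add]; congr 1; ring
    rw [this]
    calc _ ≤ Real.exp (δ / 2 * t) * (Q * Real.exp (δ / 2 * t)) := by gcongr
      _ = _ := by ring
  rw [Real.exp_neg, inv_le_iff_one_le_mul₀ (Real.exp_pos _)]
  exact hone'

end Binomial

/-! ### Long edges of optimal and greedy matchings -/

section Locality

variable {d : ℕ}

/-- The indices of the edges of length greater than `ε` with both endpoints in the ball of
radius `R`. -/
noncomputable def longEdges {ι : Type*} [Fintype ι] (R ε : ℝ) (z : ι → Pt d)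
    (σ : Equiv.Perm ι) : Finset ι :=
  letI := Classical.decPred fun k => ‖z k‖ ≤ R ∧ ‖z (σ k)‖ ≤ R ∧ ε < ‖z k - z (σ k)‖
  Finset.univ.filter fun k => ‖z k‖ ≤ R ∧ ‖z (σ k)‖ ≤ R ∧ ε < ‖z k - z (σ k)‖

lemma mem_longEdges {ι : Type*} [Fintype ι] {R ε : ℝ} {z : ι → Pt d} {σ : Equiv.Perm ι} {k : ι} :
    k ∈ longEdges R ε z σ ↔ ‖z k‖ ≤ R ∧ ‖z (σ k)‖ ≤ R ∧ ε < ‖z k - z (σ k)‖ := by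
  simp [longEdges]

/-- A ball is divided into finitely many cells of diameter at most `δ`; `c` chooses a point in each
cell. -/
lemma exists_cells (d : ℕ) (R : ℝ) {δ : ℝ} (hδ : 0 < δ) :
    ∃ (s : Finset (Pt d)) (c : Pt d → Pt d), ∀ x, ‖x‖ ≤ R →
      c x ∈ s ∧ ∀ y, ‖y‖ ≤ R → c x = c y → ‖x - y‖ ≤ δ := by
  obtain ⟨t, -, ht, hcov⟩ :=
    (isCompact_closedBall (0 : Pt d) R).finite_cover_balls (half_pos hδ)
  have h : ∀ x : Pt d, ∃ y, ‖x‖ ≤ R → y ∈ t ∧ dist x y < δ / 2 := by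
    intro x
    by_cases hx : ‖x‖ ≤ R
    · have := hcov (mem_closedBall_zero_iff.2 hx)
      simp only [Set.mem_iUnion, Metric.mem_ball, exists_prop] at this
      obtain ⟨y, hy, hxy⟩ := this
      exact ⟨y, fun _ => ⟨hy, hxy⟩⟩
    · exact ⟨0, fun h => absurd h hx⟩
  choose c hc using h
  refine ⟨ht.toFinset, c, fun x hx => ⟨by simpa using (hc x hx).1, fun y hy hxy => ?_⟩⟩
  have h1 := (hc x hx).2
  have h2 := (hc y hy).2
  rw [← hxy] at h2
  have := dist_triangle_right x y (c x)
  rw [← dist_eq_norm]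
  linarith

/-- The cost function tends to `0` at `0` and is positive on `(0, ∞)`. -/
lemma exists_lam_lt {lam : ℝ → ℝ} {α : ℝ} (hα : 0 < α) (hmono : MonotoneOn lam (Set.Ici 0))
    (hlam : lam =Θ[𝓝[>] (0 : ℝ)] fun b : ℝ => b ^ α) {ε : ℝ} (hε : 0 < ε) :
    ∃ δ, 0 < δ ∧ lam δ < lam ε := by
  have hpow : Tendsto (fun b : ℝ => b ^ α) (𝓝[>] 0) (𝓝 0) := by
    have := (Real.continuousAt_rpow_const 0 α (Or.inr hα.le)).tendsto
    rw [Real.zero_rpow hα.ne'] at this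
    exact this.mono_left nhdsWithin_le_nhds
  have hlim : Tendsto lam (𝓝[>] 0) (𝓝 0) := hlam.1.trans_tendsto hpow
  have hnn : ∀ b, 0 < b → 0 ≤ lam b := by
    intro b hb
    refine le_of_tendsto hlim ?_
    filter_upwards [Ioc_mem_nhdsGT hb] with x hx
    exact hmono hx.1.le hb.le hx.2
  have hne : ∀ᶠ b in 𝓝[>] (0 : ℝ), lam b ≠ 0 := by
    filter_upwards [hlam.2.eq_zero_imp, self_mem_nhdsWithin] with b hb hb0 h
    exact (Real.rpow_pos_of_pos hb0 α).ne' (hb h)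
  obtain ⟨b, hb, hbε⟩ := (hne.and (Ioc_mem_nhdsGT hε)).exists
  have hpos : 0 < lam ε :=
    ((hnn b hbε.1).lt_of_ne' hb).trans_le (hmono hbε.1.le hε.le hbε.2)
  obtain ⟨δ, hδ, hδ0⟩ := ((hlim.eventually_lt_const hpos).and self_mem_nhdsWithin).exists
  exact ⟨δ, hδ0, hδ⟩

lemma IsMatching.conj {ι : Type*} {σ : Equiv.Perm ι} (hσ : IsMatching σ) (ρ : Equiv.Perm ι) :
    IsMatching (ρ * σ * ρ⁻¹) := by
  constructor
  · intro k
    simp [Equiv.Perm.mul_apply, hσ.involutive]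
  · intro a ha b hb
    simp only [Set.mem_ofPred_eq, Equiv.Perm.mul_apply] at ha hb
    have ha' : σ (ρ⁻¹ a) = ρ⁻¹ a := by rw [Equiv.Perm.eq_inv_iff_eq]; exact ha
    have hb' : σ (ρ⁻¹ b) = ρ⁻¹ b := by rw [Equiv.Perm.eq_inv_iff_eq]; exact hb
    exact ρ⁻¹.injective (hσ.fixed_subsingleton ha' hb')

/-- Between two cells of small diameter an optimal matching has at most one long edge: two such
edges could be replaced by an edge inside each cell. Hence there are few long edges in a ball. -/
lemma IsOptimalMatching.exists_card_longEdges_le (d : ℕ) {lam : ℝ → ℝ} {α : ℝ} (hα : 0 < α)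
    (hmono : MonotoneOn lam (Set.Ici 0))
    (hlam : lam =Θ[𝓝[>] (0 : ℝ)] fun b : ℝ => b ^ α) (R : ℝ) {ε : ℝ} (hε : 0 < ε) :
    ∃ C : ℕ, ∀ (t : ℕ) (z : Fin t → Pt d) (σ : Equiv.Perm (Fin t)),
      IsOptimalMatching lam z σ → (longEdges R ε z σ).card ≤ C := by
  obtain ⟨δ, hδ, hδε⟩ := exists_lam_lt hα hmono hlam hε
  have hlt : δ < ε := by
    by_contra h
    exact absurd (hmono hε.le hδ.le (not_lt.1 h)) (not_le.2 hδε)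
  obtain ⟨s, c, hc⟩ := exists_cells d R hδ
  refine ⟨(s ×ˢ s).card, fun t z σ hσ => ?_⟩
  refine Finset.card_le_card_of_injOn (fun k => (c (z k), c (z (σ k)))) ?_ ?_
  · intro k hk
    rw [Finset.mem_coe, mem_longEdges] at hk
    exact Finset.mem_coe.2 (Finset.mem_product.2 ⟨(hc _ hk.1).1, (hc _ hk.2.1).1⟩)
  intro k hk l hl hkl
  rw [Finset.mem_coe, mem_longEdges] at hk hl
  by_contra hne
  have i1 := hσ.1.involutive k
  have i2 := hσ.1.involutive l
  have d1 : ‖z k - z l‖ ≤ δ := (hc _ hk.1).2 _ hl.1 (congrArg Prod.fst hkl)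
  have d2 : ‖z (σ k) - z (σ l)‖ ≤ δ := (hc _ hk.2.1).2 _ hl.2.1 (congrArg Prod.snd hkl)
  have d1' : ‖z l - z k‖ ≤ δ := by rwa [norm_sub_rev]
  have d2' : ‖z (σ l) - z (σ k)‖ ≤ δ := by rwa [norm_sub_rev]
  have n1 : σ k ≠ l := by
    rintro rfl
    linarith [hk.2.2]
  have n2 : σ l ≠ k := fun h => n1 (by rw [← h, i2])
  have n3 : σ k ≠ k := by
    intro h
    have := hk.2.2
    rw [h, sub_self, norm_zero] at this
    linarith
  have n4 : σ l ≠ l := by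
    intro h
    have := hl.2.2
    rw [h, sub_self, norm_zero] at this
    linarith
  have n5 : σ k ≠ σ l := fun h => hne (σ.injective h)
  -- Conjugating by the transposition of `σ k` and `l` pairs `k` with `l` and `σ k` with `σ l`.
  set ρ : Equiv.Perm (Fin t) := Equiv.swap (σ k) l with hρ
  have r1 : ρ k = k := Equiv.swap_apply_of_ne_of_ne n3.symm hne
  have r2 : ρ (σ l) = σ l := Equiv.swap_apply_of_ne_of_ne n5.symm n4
  have r3 : ρ (σ k) = l := Equiv.swap_apply_left _ _
  have r4 : ρ l = σ k := Equiv.swap_apply_right _ _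
  have hinv : ρ⁻¹ = ρ := Equiv.swap_inv _ _
  have τ1 : (ρ * σ * ρ⁻¹) k = l := by simp [hinv, r1, r3]
  have τ2 : (ρ * σ * ρ⁻¹) l = k := by simp [hinv, r4, i1, r1]
  have τ3 : (ρ * σ * ρ⁻¹) (σ k) = σ l := by simp [hinv, r3, r2]
  have τ4 : (ρ * σ * ρ⁻¹) (σ l) = σ k := by simp [hinv, r2, i2, r4]
  have hshort : ∀ {x : ℝ}, 0 ≤ x → x ≤ δ → lam x < lam ε := fun h0 h =>
    (hmono h0 hδ.le h).trans_lt hδε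
  have hlong : ∀ {x : ℝ}, ε < x → lam ε ≤ lam x := fun h =>
    hmono hε.le (hε.trans h).le h.le
  have lk := hk.2.2
  have ll := hl.2.2
  have lk' : ε < ‖z (σ k) - z k‖ := by rw [norm_sub_rev]; exact lk
  have ll' : ε < ‖z (σ l) - z l‖ := by rw [norm_sub_rev]; exact ll
  refine absurd (hσ.2 _ (hσ.1.conj ρ)) (not_le.2 ?_)
  refine Finset.sum_lt_sum (fun j _ => ?_) ⟨k, Finset.mem_univ k, ?_⟩
  · by_cases j1 : j = k
    · subst j1; rw [τ1]; exact ((hshort (norm_nonneg _) d1).trans_le (hlong lk)).le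
    by_cases j2 : j = l
    · subst j2; rw [τ2]; exact ((hshort (norm_nonneg _) d1').trans_le (hlong ll)).le
    by_cases j3 : j = σ k
    · subst j3; rw [τ3, i1]; exact ((hshort (norm_nonneg _) d2).trans_le (hlong lk')).le
    by_cases j4 : j = σ l
    · subst j4; rw [τ4, i2]; exact ((hshort (norm_nonneg _) d2').trans_le (hlong ll')).le
    have s1 : ρ j = j := Equiv.swap_apply_of_ne_of_ne j3 j2
    have s2 : ρ (σ j) = σ j := Equiv.swap_apply_of_ne_of_ne (fun h => j1 (σ.injective h))
      (fun h => j4 (by rw [← h, hσ.1.involutive]))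
    have : (ρ * σ * ρ⁻¹) j = σ j := by simp [hinv, s1, s2]
    rw [this]
  · rw [τ1]; exact (hshort (norm_nonneg _) d1).trans_le (hlong lk)

section Greedy

variable {ι : Type*} [DecidableEq ι] {z : ι → Pt d}

lemma GreedyRun.apply_of_notMem {R : Finset ι} {σ : Equiv.Perm ι} (h : GreedyRun z R σ) {k : ι}
    (hk : k ∉ R) : σ k = k := by
  induction h with
  | base R hR => rfl
  | step R i j σ hi hj hij closest rest ih =>
    have h1 : σ k = k := ih fun h => hk (Finset.mem_of_mem_erase (Finset.mem_of_mem_erase h))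
    rw [Equiv.Perm.mul_apply, h1]
    exact Equiv.swap_apply_of_ne_of_ne (fun h => hk (h ▸ hi)) (fun h => hk (h ▸ hj))

/-- The remaining steps of the greedy procedure do not move a removed pair. -/
lemma GreedyRun.swap_mul_apply {R : Finset ι} {i j : ι} {σ : Equiv.Perm ι}
    (h : GreedyRun z ((R.erase i).erase j) σ) :
    (Equiv.swap i j * σ) i = j ∧ (Equiv.swap i j * σ) j = i ∧
      ∀ k, k ≠ i → k ≠ j → (Equiv.swap i j * σ) k = σ k ∧ σ k ≠ i ∧ σ k ≠ j := by
  have hi : σ i = i := h.apply_of_notMem (by simp)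
  have hj : σ j = j := h.apply_of_notMem (by simp)
  refine ⟨by simp [hi], by simp [hj], fun k h1 h2 => ?_⟩
  have e1 : σ k ≠ i := fun e => h1 (σ.injective (e.trans hi.symm))
  have e2 : σ k ≠ j := fun e => h2 (σ.injective (e.trans hj.symm))
  exact ⟨Equiv.swap_apply_of_ne_of_ne e1 e2, e1, e2⟩

lemma GreedyRun.involutive {R : Finset ι} {σ : Equiv.Perm ι} (h : GreedyRun z R σ) (k : ι) :
    σ (σ k) = k := by
  induction h generalizing k with
  | base R hR => rfl
  | step R i j σ hi hj hij closest rest ih =>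
    obtain ⟨h1, h2, h3⟩ := rest.swap_mul_apply
    by_cases ki : k = i
    · rw [ki, h1, h2]
    by_cases kj : k = j
    · rw [kj, h2, h1]
    obtain ⟨a, b, c⟩ := h3 k ki kj
    rw [a, (h3 _ b c).1, ih]

lemma GreedyRun.fixed_subsingleton {R : Finset ι} {σ : Equiv.Perm ι} (h : GreedyRun z R σ) :
    {k | k ∈ R ∧ σ k = k}.Subsingleton := by
  induction h with
  | base R hR =>
    intro a ha b hb
    exact Finset.card_le_one.1 hR a ha.1 b hb.1
  | step R i j σ hi hj hij closest rest ih =>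
    obtain ⟨h1, h2, h3⟩ := rest.swap_mul_apply
    have key : ∀ k, k ∈ R ∧ (Equiv.swap i j * σ) k = k →
        k ∈ (R.erase i).erase j ∧ σ k = k := by
      rintro k ⟨hk, hf⟩
      have ki : k ≠ i := by rintro rfl; exact hij (hf.symm.trans h1)
      have kj : k ≠ j := by rintro rfl; exact hij (h2.symm.trans hf)
      exact ⟨by simp [ki, kj, hk], by rw [← (h3 k ki kj).1, hf]⟩
    intro a ha b hb
    exact ih (key a ha) (key b hb)

variable [Fintype ι]

lemma IsGreedyMatching.isMatching {σ : Equiv.Perm ι} (h : IsGreedyMatching z σ) : IsMatching σ :=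
  ⟨GreedyRun.involutive h, fun a ha b hb => GreedyRun.fixed_subsingleton h
    ⟨Finset.mem_univ a, ha⟩ ⟨Finset.mem_univ b, hb⟩⟩

/-- The number of long edges is at most the number of cells of diameter at most `ε`. -/
lemma GreedyRun.card_longEdges_le {R ε : ℝ} {s : Finset (Pt d)} {c : Pt d → Pt d}
    (hc : ∀ x, ‖x‖ ≤ R → c x ∈ s ∧ ∀ y, ‖y‖ ≤ R → c x = c y → ‖x - y‖ ≤ ε)
    {Q : Finset ι} {σ : Equiv.Perm ι} (h : GreedyRun z Q σ) :
    (longEdges R ε z σ ∩ Q).card ≤ s.card := by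
  induction h with
  | base Q hQ =>
    rw [Finset.card_eq_zero.2]
    · exact Nat.zero_le _
    · rw [Finset.eq_empty_iff_forall_notMem]
      intro k hk
      rw [Finset.mem_inter, mem_longEdges] at hk
      -- Here the permutation is the identity, and the cell condition for `x = y` forces `0 ≤ ε`.
      have := (hc _ hk.1.1).2 _ hk.1.2.1 rfl
      exact absurd hk.1.2.2 (not_lt.2 this)
  | step Q i j σ hi hj hij closest rest ih =>
    obtain ⟨h1, h2, h3⟩ := rest.swap_mul_apply
    rcases lt_or_ge ε ‖z i - z j‖ with hlong | hshort
    · -- All remaining points are far apart from each other.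
      refine Finset.card_le_card_of_injOn (fun k => c (z k)) ?_ ?_
      · intro k hk
        rw [Finset.mem_coe, Finset.mem_inter, mem_longEdges] at hk
        exact (hc _ hk.1.1).1
      · intro k hk l hl hkl
        rw [Finset.mem_coe, Finset.mem_inter, mem_longEdges] at hk hl
        by_contra hne
        have a1 := closest k hk.2 l hl.2 hne
        have a2 := (hc _ hk.1.1).2 _ hl.1.1 hkl
        linarith
    · refine le_trans (Finset.card_le_card fun k hk => ?_) ih
      rw [Finset.mem_inter, mem_longEdges] at hk ⊢
      have ki : k ≠ i := by
        rintro rfl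
        have := hk.1.2.2
        rw [h1] at this
        linarith
      have kj : k ≠ j := by
        rintro rfl
        have := hk.1.2.2
        rw [h2, norm_sub_rev] at this
        linarith
      rw [(h3 k ki kj).1] at hk
      exact ⟨hk.1, by simp [ki, kj, hk.2]⟩

end Greedy

/-- A greedy matching has few long edges in a ball: as soon as it chooses a long edge, the remaining
points are far apart from each other. -/
lemma IsGreedyMatching.exists_card_longEdges_le (d : ℕ) (R : ℝ) {ε : ℝ} (hε : 0 < ε) :
    ∃ C : ℕ, ∀ (t : ℕ) (z : Fin t → Pt d) (σ : Equiv.Perm (Fin t)),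
      IsGreedyMatching z σ → (longEdges R ε z σ).card ≤ C := by
  obtain ⟨s, c, hc⟩ := exists_cells d R hε
  refine ⟨s.card, fun t z σ hσ => ?_⟩
  have := GreedyRun.card_longEdges_le hc hσ
  rwa [Finset.inter_univ] at this

end Locality

/-! ### Product measures -/

section ProductMeasures

open scoped ENNReal

variable {ι α : Type*} [Fintype ι] [MeasurableSpace α]

lemma lintegral_pi_prod (μ : ι → Measure α) [∀ i, IsProbabilityMeasure (μ i)] (F : ι → α → ℝ≥0∞)
    (hF : ∀ i, Measurable (F i)) :
    ∫⁻ z, ∏ i, F i (z i) ∂Measure.pi μ = ∏ i, ∫⁻ x, F i x ∂μ i := by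
  have h := ProbabilityTheory.lintegral_prod_eq_prod_lintegral_of_indepFun (μ := Measure.pi μ)
    Finset.univ (fun i z => F i (z i))
    (ProbabilityTheory.iIndepFun_pi (fun i => (hF i).aemeasurable))
    (fun i => (hF i).comp (measurable_pi_apply i))
  rw [h]
  refine Finset.prod_congr rfl fun i _ => ?_
  exact (measurePreserving_eval μ i).lintegral_comp (hF i)

lemma pi_withDensity (μ : Measure α) [IsProbabilityMeasure μ] (h : ι → α → ℝ≥0∞)
    (hh : ∀ i, Measurable (h i)) [∀ i, SigmaFinite (μ.withDensity (h i))] :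
    Measure.pi (fun i => μ.withDensity (h i)) =
      (Measure.pi fun _ => μ).withDensity fun z => ∏ i, h i (z i) := by
  refine Measure.pi_eq fun s hs => ?_
  rw [withDensity_apply _ (MeasurableSet.univ_pi hs),
    ← lintegral_indicator (MeasurableSet.univ_pi hs)]
  have : ∀ z : ι → α, (Set.univ.pi s).indicator (fun z => ∏ i, h i (z i)) z =
      ∏ i, (s i).indicator (h i) (z i) := by
    intro z
    by_cases hz : z ∈ Set.univ.pi s
    · rw [Set.indicator_of_mem hz]
      refine Finset.prod_congr rfl fun i _ => ?_
      rw [Set.indicator_of_mem (hz i (Set.mem_univ i))]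
    · rw [Set.indicator_of_notMem hz]
      simp only [Set.mem_pi, Set.mem_univ, true_imp_iff, not_forall] at hz
      obtain ⟨i, hi⟩ := hz
      exact (Finset.prod_eq_zero (Finset.mem_univ i) (Set.indicator_of_notMem hi _)).symm
  simp_rw [this]
  rw [lintegral_pi_prod (fun _ => μ) _ fun i => (hh i).indicator (hs i)]
  refine Finset.prod_congr rfl fun i _ => ?_
  rw [lintegral_indicator (hs i), withDensity_apply _ (hs i)]

lemma ae_injective_pi [MeasurableEq α] [MeasurableSingletonClass α] (μ : ι → Measure α)
    [∀ i, IsProbabilityMeasure (μ i)] [∀ i, NullSingletonClass (μ i)] :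
    ∀ᵐ z ∂Measure.pi μ, Function.Injective z := by
  have key : ∀ i j, i ≠ j → ∀ᵐ z ∂Measure.pi μ, z i ≠ z j := by
    intro i j hij
    have hind := (ProbabilityTheory.iIndepFun_pi (μ := μ) (X := fun i (x : α) => x)
      (fun i => aemeasurable_id)).indepFun hij
    have hmap := (ProbabilityTheory.indepFun_iff_map_prod_eq_prod_map_map
      (measurable_pi_apply i).aemeasurable (measurable_pi_apply j).aemeasurable).1 hind
    rw [(measurePreserving_eval μ i).map_eq, (measurePreserving_eval μ j).map_eq] at hmap
    have hdiag : MeasurableSet {q : α × α | q.1 = q.2} :=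
      measurableSet_eq_fun measurable_fst measurable_snd
    have h0 : (μ i).prod (μ j) {q : α × α | q.1 = q.2} = 0 := by
      rw [Measure.prod_apply hdiag]
      simp
    rw [← hmap, Measure.map_apply
      ((measurable_pi_apply i).prodMk (measurable_pi_apply j)) hdiag] at h0
    rw [ae_iff]
    simpa using h0
  have : ∀ᵐ z ∂Measure.pi μ, ∀ i j, i ≠ j → z i ≠ z j := by
    rw [ae_all_iff]; intro i
    rw [ae_all_iff]; intro j
    by_cases hij : i = j
    · simp [hij]
    · filter_upwards [key i j hij] with z hz _ using hz
  filter_upwards [this] with z hz i j h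
  by_contra hne
  exact hz i j hne h

end ProductMeasures

/-! ### Exchangeability of the labels -/

section Laws

open scoped ENNReal

variable {d : ℕ} {U : Type*} [MeasurableSpace U]

lemma IsDensity.isProbabilityMeasure {f : Pt d → ℝ} (hf : IsDensity f) :
    IsProbabilityMeasure (law f) :=
  ⟨by rw [law, withDensity_apply _ MeasurableSet.univ, setLIntegral_univ, hf.lintegral_eq_one]⟩

lemma nullSingletonClass_law (hd : 1 ≤ d) (f : Pt d → ℝ) : NullSingletonClass (law f) := by
  have : Nonempty (Fin d) := ⟨⟨0, hd⟩⟩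
  refine ⟨fun x => ?_⟩
  exact withDensity_absolutelyContinuous _ _ (measure_singleton x)

/-- The law of independent points `z k`, with density `f` for `k ∈ A` and density `g` otherwise. -/
noncomputable def labelLaw {N : ℕ} (f g : Pt d → ℝ) (A : Finset (Fin N)) :
    Measure (Fin N → Pt d) :=
  Measure.pi fun k => if k ∈ A then law f else law g

lemma isProbabilityMeasure_ite {f g : Pt d → ℝ} (hf : IsDensity f) (hg : IsDensity g) (P : Prop)
    [Decidable P] : IsProbabilityMeasure (if P then law f else law g) := by
  split_ifs
  exacts [hf.isProbabilityMeasure, hg.isProbabilityMeasure]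

lemma isProbabilityMeasure_labelLaw {N : ℕ} {f g : Pt d → ℝ} (hf : IsDensity f) (hg : IsDensity g)
    (A : Finset (Fin N)) : IsProbabilityMeasure (labelLaw f g A) := by
  have := fun k => isProbabilityMeasure_ite hf hg (k ∈ A)
  unfold labelLaw
  infer_instance

lemma isProbabilityMeasure_sampleLaw (κ : Measure U) [IsProbabilityMeasure κ] (m n : ℕ)
    {f g : Pt d → ℝ} (hf : IsDensity f) (hg : IsDensity g) :
    IsProbabilityMeasure (sampleLaw κ m n f g) := by
  have := hf.isProbabilityMeasure
  have := hg.isProbabilityMeasure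
  unfold sampleLaw
  infer_instance

lemma ae_injective_labelLaw (hd : 1 ≤ d) {N : ℕ} {f g : Pt d → ℝ} (hf : IsDensity f)
    (hg : IsDensity g) (A : Finset (Fin N)) : ∀ᵐ z ∂labelLaw f g A, Function.Injective z := by
  have := fun k => isProbabilityMeasure_ite hf hg (k ∈ A)
  have : ∀ k, NullSingletonClass (if k ∈ A then law f else law g) := by
    intro k
    split_ifs
    exacts [nullSingletonClass_law hd f, nullSingletonClass_law hd g]
  exact ae_injective_pi _

lemma measurable_append (m n : ℕ) :
    Measurable fun w : (Fin m → Pt d) × (Fin n → Pt d) => Fin.append w.1 w.2 := by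
  refine measurable_pi_iff.2 fun k => ?_
  induction k using Fin.addCases with
  | left i => simp only [Fin.append_left]; fun_prop
  | right i => simp only [Fin.append_right]; fun_prop

lemma map_append {f g : Pt d → ℝ} (hf : IsDensity f) (hg : IsDensity g) (m n : ℕ) :
    Measure.map (fun w : (Fin m → Pt d) × (Fin n → Pt d) => Fin.append w.1 w.2)
      ((Measure.pi fun _ => law f).prod (Measure.pi fun _ => law g)) =
        labelLaw f g (firstSample m n) := by
  have := hf.isProbabilityMeasure
  have := hg.isProbabilityMeasure
  have := fun k => isProbabilityMeasure_ite hf hg (k ∈ firstSample m n)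
  refine (Measure.pi_eq fun s hs => ?_).symm
  rw [Measure.map_apply (measurable_append m n) (MeasurableSet.univ_pi hs)]
  have : (fun w : (Fin m → Pt d) × (Fin n → Pt d) => Fin.append w.1 w.2) ⁻¹' (Set.univ.pi s) =
      (Set.univ.pi fun i => s (Fin.castAdd n i)) ×ˢ (Set.univ.pi fun j => s (Fin.natAdd m j)) := by
    ext w
    simp only [Set.mem_preimage, Set.mem_pi, Set.mem_univ, true_imp_iff, Set.mem_prod]
    constructor
    · intro h
      exact ⟨fun i => by simpa using h (Fin.castAdd n i),
        fun j => by simpa using h (Fin.natAdd m j)⟩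
    · rintro ⟨h1, h2⟩ k
      induction k using Fin.addCases with
      | left i => simpa using h1 i
      | right i => simpa using h2 i
  rw [this, Measure.prod_prod, Measure.pi_pi, Measure.pi_pi, Fin.prod_univ_add]
  simp [castAdd_mem_firstSample, natAdd_notMem_firstSample]

lemma map_comp_perm {N : ℕ} {f g : Pt d → ℝ} (hf : IsDensity f) (hg : IsDensity g)
    {A B : Finset (Fin N)} {π : Equiv.Perm (Fin N)} (h : ∀ k, π k ∈ B ↔ k ∈ A) :
    Measure.map (fun z : Fin N → Pt d => z ∘ π) (labelLaw f g B) = labelLaw f g A := by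
  have := fun k => isProbabilityMeasure_ite hf hg (k ∈ A)
  have := fun k => isProbabilityMeasure_ite hf hg (k ∈ B)
  refine (Measure.pi_eq fun s hs => ?_).symm
  rw [Measure.map_apply (by fun_prop) (MeasurableSet.univ_pi hs)]
  have e : (fun z : Fin N → Pt d => z ∘ π) ⁻¹' (Set.univ.pi s) =
      Set.univ.pi fun k => s (π.symm k) := by
    ext z
    simp only [Set.mem_preimage, Set.mem_pi, Set.mem_univ, true_imp_iff, Function.comp_apply]
    exact ⟨fun h k => by simpa using h (π.symm k), fun h k => by simpa using h (π k)⟩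
  rw [e, labelLaw, Measure.pi_pi, ← Equiv.prod_comp π]
  refine Finset.prod_congr rfl fun k _ => ?_
  simp [h]

lemma exists_perm_of_card_eq {N : ℕ} {A B : Finset (Fin N)} (h : A.card = B.card) :
    ∃ π : Equiv.Perm (Fin N), ∀ k, π k ∈ B ↔ k ∈ A := by
  have e : {x // x ∈ A} ≃ {x // x ∈ B} := Fintype.equivOfCardEq (by simpa using h)
  refine ⟨e.extendSubtype, fun k => ⟨fun hk => ?_, fun hk => e.extendSubtype_mem k hk⟩⟩
  by_contra hk'
  exact e.extendSubtype_not_mem k hk' hk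

lemma MatchingRule.measurable_crossCount (G : MatchingRule d U) (t : ℕ) (A : Finset (Fin t)) :
    Measurable fun w : U × (Fin t → Pt d) => crossCount A (G.perm t w.1 w.2) := by
  have h : ∀ k, MeasurableSet {w : U × (Fin t → Pt d) | ¬(k ∈ A ↔ G.perm t w.1 w.2 k ∈ A)} := by
    intro k
    have h1 : MeasurableSet {w : U × (Fin t → Pt d) | G.perm t w.1 w.2 k ∈ A} := by
      have : {w : U × (Fin t → Pt d) | G.perm t w.1 w.2 k ∈ A} =
          ⋃ j ∈ A, {w | G.perm t w.1 w.2 k = j} := by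
        ext w; simp
      rw [this]
      exact Finset.measurableSet_biUnion _ fun j _ => G.measurable t k j
    by_cases hk : k ∈ A
    · have : {w : U × (Fin t → Pt d) | ¬(k ∈ A ↔ G.perm t w.1 w.2 k ∈ A)} =
          {w | G.perm t w.1 w.2 k ∈ A}ᶜ := by
        ext w; simp [hk]
      rw [this]
      exact h1.compl
    · simpa [hk] using h1
  have e : (fun w : U × (Fin t → Pt d) => crossCount A (G.perm t w.1 w.2)) =
      fun w => ∑ k, if ¬(k ∈ A ↔ G.perm t w.1 w.2 k ∈ A) then 1 else 0 := by
    ext w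
    rw [crossCount, Finset.card_filter]
  rw [e]
  exact Finset.measurable_sum _ fun k _ => Measurable.ite (h k) measurable_const measurable_const

lemma MatchingRule.measurableSet_crossCount_mem (G : MatchingRule d U) (t : ℕ)
    (A : Finset (Fin t)) (S : Set ℕ) :
    MeasurableSet {w : U × (Fin t → Pt d) | crossCount A (G.perm t w.1 w.2) ∈ S} :=
  (G.measurable_crossCount t A) MeasurableSet.of_discrete

lemma measurableSet_chi_mem (G : MatchingRule d U) (m n : ℕ) (S : Set ℕ) :
    MeasurableSet {w : U × ((Fin m → Pt d) × (Fin n → Pt d)) |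
      chi m n (G.perm (m + n) w.1 (Fin.append w.2.1 w.2.2)) ∈ S} := by
  simp_rw [chi_eq_crossCount]
  have h1 : Measurable fun w : U × ((Fin m → Pt d) × (Fin n → Pt d)) =>
      (w.1, Fin.append w.2.1 w.2.2) :=
    measurable_fst.prodMk ((measurable_append m n).comp measurable_snd)
  exact ((G.measurable_crossCount (m + n) (firstSample m n)).comp h1) (MeasurableSet.of_discrete)

/-- Exchangeability: since the matching is a function of the unordered set of points, the law of
`χ` is unchanged if the first sample is placed at any other set `A` of `m` indices. -/
lemma sampleLaw_chi_mem (hd : 1 ≤ d) (κ : Measure U) [IsProbabilityMeasure κ]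
    (G : MatchingRule d U) {m n : ℕ} {f g : Pt d → ℝ} (hf : IsDensity f) (hg : IsDensity g)
    (S : Set ℕ) {A : Finset (Fin (m + n))} (hA : A.card = m) :
    sampleLaw κ m n f g {w | chi m n (G.perm (m + n) w.1 (Fin.append w.2.1 w.2.2)) ∈ S} =
      (κ.prod (labelLaw f g A)) {w | crossCount A (G.perm (m + n) w.1 w.2) ∈ S} := by
  have := hf.isProbabilityMeasure
  have := hg.isProbabilityMeasure
  have := isProbabilityMeasure_labelLaw hf hg A
  rw [sampleLaw, Measure.prod_apply (measurableSet_chi_mem G m n S),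
    Measure.prod_apply (G.measurableSet_crossCount_mem _ A S)]
  refine lintegral_congr fun u => ?_
  have hms : ∀ B : Finset (Fin (m + n)),
      MeasurableSet {z : Fin (m + n) → Pt d | crossCount B (G.perm (m + n) u z) ∈ S} := fun B =>
    ((G.measurable_crossCount (m + n) B).comp measurable_prodMk_left)
      (MeasurableSet.of_discrete)
  have e1 : (Prod.mk u ⁻¹' {w : U × ((Fin m → Pt d) × (Fin n → Pt d)) |
      chi m n (G.perm (m + n) w.1 (Fin.append w.2.1 w.2.2)) ∈ S}) =
      (fun w : (Fin m → Pt d) × (Fin n → Pt d) => Fin.append w.1 w.2) ⁻¹'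
        {z | crossCount (firstSample m n) (G.perm (m + n) u z) ∈ S} := by
    ext w; simp [chi_eq_crossCount]
  rw [e1, ← Measure.map_apply (measurable_append m n) (hms _), map_append hf hg]
  obtain ⟨π, hπ⟩ := exists_perm_of_card_eq ((card_firstSample m n).trans hA.symm)
  rw [← map_comp_perm hf hg hπ, Measure.map_apply (by fun_prop) (hms _)]
  refine measure_congr ?_
  filter_upwards [ae_injective_labelLaw hd hf hg A] with z hz
  refine propext ?_
  change crossCount _ (G.perm (m + n) u (z ∘ π)) ∈ S ↔ crossCount A (G.perm (m + n) u z) ∈ S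
  rw [G.unordered _ u z π hz, crossCount_conj _ _ _ _ hπ]

end Laws

/-! ### The size of the test -/

section Size

open scoped ENNReal

variable {d : ℕ} {U : Type*} [MeasurableSpace U]

/-- The rule pairs the points by a matching. -/
def MatchingRule.IsMatchingRule (G : MatchingRule d U) : Prop :=
  ∀ (t : ℕ) (u : U) (z : Fin t → Pt d), Function.Injective z → IsMatching (G.perm t u z)

lemma rejectProb_eq (hd : 1 ≤ d) (κ : Measure U) [IsProbabilityMeasure κ]
    (G : MatchingRule d U) {m n : ℕ} {f g : Pt d → ℝ} (hf : IsDensity f) (hg : IsDensity g)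
    (c : ℝ) {A : Finset (Fin (m + n))} (hA : A.card = m) :
    rejectProb κ G m n c f g = (κ.prod (labelLaw f g A))
      {w | (crossCount A (G.perm (m + n) w.1 w.2) : ℝ) / ((m + n : ℕ) : ℝ) < c} :=
  sampleLaw_chi_mem hd κ G hf hg {x : ℕ | (x : ℝ) / ((m + n : ℕ) : ℝ) < c} hA

/-- Under the null hypothesis the statistic is that of a uniformly random labelling of a matching,
so Chebyshev's inequality applies, uniformly in `f`. -/
lemma rejectProb_null_le (hd : 1 ≤ d) (κ : Measure U) [IsProbabilityMeasure κ]
    {G : MatchingRule d U} (hG : G.IsMatchingRule) {m n : ℕ} (hN : 2 ≤ m + n) {f : Pt d → ℝ}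
    (hf : IsDensity f) {c y : ℝ} (hy : 0 < y)
    (hc : c * ((m + n : ℕ) : ℝ) ≤ 2 * m - 2 * m ^ 2 / ((m + n : ℕ) : ℝ) - 2 * y) :
    rejectProb κ G m n c f f ≤ ENNReal.ofReal (2 * ((m + n : ℕ) : ℝ) / y ^ 2) := by
  classical
  set N := m + n with hNdef
  have hN0 : (0 : ℝ) < (N : ℝ) := by positivity
  have := hf.isProbabilityMeasure
  set P : Measure (Fin N → Pt d) := Measure.pi fun _ => law f with hP
  have hPA : ∀ A : Finset (Fin N), labelLaw f f A = P := by
    intro A; simp [labelLaw, hP]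
  have hmle : m ≤ Fintype.card (Fin N) := by simp [hNdef]
  set T := (Finset.univ : Finset (Fin N)).powersetCard m with hT
  have hTcard : (T.card : ℝ≥0∞) = ENNReal.ofReal (N.choose m) := by
    rw [hT, Finset.card_powersetCard, Finset.card_univ, Fintype.card_fin, ENNReal.ofReal_natCast]
  let E : Finset (Fin N) → Set (U × (Fin N → Pt d)) := fun A =>
    {w | (crossCount A (G.perm N w.1 w.2) : ℝ) / (N : ℝ) < c}
  have hE : ∀ A, MeasurableSet (E A) := fun A =>
    G.measurableSet_crossCount_mem N A {x : ℕ | (x : ℝ) / (N : ℝ) < c}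
  have h1 : (T.card : ℝ≥0∞) * rejectProb κ G m n c f f = ∑ A ∈ T, (κ.prod P) (E A) := by
    rw [← nsmul_eq_mul, ← Finset.sum_const]
    refine Finset.sum_congr rfl fun A hA => ?_
    rw [rejectProb_eq hd κ G hf hf c (Finset.mem_powersetCard.1 hA).2, hPA]
  have h2 : ∑ A ∈ T, (κ.prod P) (E A) =
      ∫⁻ w, ∑ A ∈ T, (E A).indicator (fun _ => (1 : ℝ≥0∞)) w ∂(κ.prod P) := by
    rw [lintegral_finsetSum _ fun A _ => measurable_const.indicator (hE A)]
    refine Finset.sum_congr rfl fun A _ => ?_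
    rw [lintegral_indicator_const (hE A), one_mul]
  have hinj : ∀ᵐ w ∂κ.prod P, Function.Injective w.2 := by
    have := ae_injective_labelLaw (N := N) hd hf hf ∅
    rw [hPA] at this
    exact Measure.quasiMeasurePreserving_snd.ae this
  have h3 : ∀ᵐ w ∂κ.prod P, ∑ A ∈ T, (E A).indicator (fun _ => (1 : ℝ≥0∞)) w ≤
      ENNReal.ofReal (N.choose m * (2 * (N : ℝ) / y ^ 2)) := by
    filter_upwards [hinj] with w hw
    have hb := card_crossCount_lt_le (hG N w.1 w.2 hw) hmle (by simpa using hN) hy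
    rw [Fintype.card_fin] at hb
    have e : ∑ A ∈ T, (E A).indicator (fun _ => (1 : ℝ≥0∞)) w =
        ((T.filter fun A => w ∈ E A).card : ℝ≥0∞) := by
      rw [Finset.card_filter]
      push_cast
      refine Finset.sum_congr rfl fun A _ => ?_
      simp [Set.indicator_apply]
    rw [e, ← ENNReal.ofReal_natCast]
    refine ENNReal.ofReal_le_ofReal (le_trans ?_ hb)
    refine Nat.cast_le.2 (Finset.card_le_card fun A hA => ?_)
    rw [Finset.mem_filter] at hA ⊢
    refine ⟨hA.1, lt_of_lt_of_le ?_ hc⟩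
    exact (div_lt_iff₀ hN0).1 hA.2
  have h4 : (T.card : ℝ≥0∞) * rejectProb κ G m n c f f ≤
      T.card * ENNReal.ofReal (2 * (N : ℝ) / y ^ 2) := by
    rw [h1, h2]
    refine (lintegral_mono_ae h3).trans ?_
    rw [lintegral_const, measure_univ, mul_one, ENNReal.ofReal_mul (by positivity), hTcard]
  have hpos : (T.card : ℝ≥0∞) ≠ 0 := by
    have : 0 < T.card := by
      rw [hT, Finset.card_powersetCard, Finset.card_univ]
      exact Nat.choose_pos hmle
    exact_mod_cast this.ne'
  exact (ENNReal.mul_le_mul_iff_right hpos (ENNReal.natCast_ne_top _)).1 h4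

/-- Every matching rule gives a test of asymptotic size `0`. -/
lemma tendsto_size (hd : 1 ≤ d) (κ : Measure U) [IsProbabilityMeasure κ]
    {G : MatchingRule d U} (hG : G.IsMatchingRule) {p : ℝ}
    {m n : ℕ → ℕ} (hmn : ∀ t, m t + n t = t) {η : ℕ → ℝ}
    (hη_slow : Tendsto (fun t : ℕ => η t * Real.sqrt (t : ℝ)) atTop atTop)
    (hc : ∃ c : ℝ, c < 1 ∧ ∀ᶠ t : ℕ in atTop,
      2 * p * (1 - p) - 2 * ((m t : ℝ) / (t : ℝ)) * ((n t : ℝ) / (t : ℝ)) ≤ c * η t)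
    {𝓕 : Set (Pt d → ℝ)} (h𝓕 : ∀ f ∈ 𝓕, IsDensity f) :
    Tendsto (fun t : ℕ => size κ G (m t) (n t) (2 * p * (1 - p) - η t) 𝓕) atTop (𝓝 0) := by
  obtain ⟨c, hc1, hc⟩ := hc
  have hk : 0 < (1 - c) / 2 := by linarith
  have hlim : Tendsto (fun t : ℕ => ENNReal.ofReal
      (2 / ((1 - c) / 2) ^ 2 * ((η t * Real.sqrt (t : ℝ)) ^ 2)⁻¹)) atTop (𝓝 0) := by
    have h1 : Tendsto (fun t : ℕ => ((η t * Real.sqrt (t : ℝ)) ^ 2)⁻¹) atTop (𝓝 0) :=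
      tendsto_inv_atTop_zero.comp ((tendsto_pow_atTop two_ne_zero).comp hη_slow)
    have h2 := ENNReal.tendsto_ofReal (h1.const_mul (2 / ((1 - c) / 2) ^ 2))
    simpa using h2
  refine tendsto_of_tendsto_of_tendsto_of_le_of_le' tendsto_const_nhds hlim
    (Eventually.of_forall fun _ => zero_le) ?_
  filter_upwards [hc, hη_slow.eventually_gt_atTop 0, eventually_ge_atTop 2] with t h1 h2 h3
  have ht : (0 : ℝ) < t := by positivity
  have hη : 0 < η t := pos_of_mul_pos_left h2 (Real.sqrt_nonneg _)
  refine iSup₂_le fun f hf => ?_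
  set y := (1 - c) / 2 * η t * t with hy
  have hy0 : 0 < y := by positivity
  have hsum : ((m t : ℝ)) + n t = t := by exact_mod_cast hmn t
  refine (rejectProb_null_le hd κ hG (by rw [hmn t]; exact h3) (h𝓕 f hf) hy0 ?_).trans_eq ?_
  · rw [hmn t]
    have e : 2 * (m t : ℝ) - 2 * (m t : ℝ) ^ 2 / t =
        2 * ((m t : ℝ) / t) * ((n t : ℝ) / t) * t := by
      have : (n t : ℝ) = t - m t := by linarith
      rw [this]; field_simp
    rw [e, hy]
    nlinarith
  · rw [hmn t, hy]
    congr 1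
    have hs : Real.sqrt (t : ℝ) ^ 2 = t := Real.sq_sqrt ht.le
    rw [mul_pow (η t), hs]
    field_simp

end Size

/-! ### The mixture of the two densities -/

section Mixture

open scoped ENNReal

variable {d : ℕ}

/-- The mixture `p f + (1 - p) g` of two densities. -/
def mixture (p : ℝ) (f g : Pt d → ℝ) (x : Pt d) : ℝ := p * f x + (1 - p) * g x

/-- The conditional probability that a point of the mixture comes from the first sample; the value
is `0` where both densities vanish. -/
noncomputable def firstProb (p : ℝ) (f g : Pt d → ℝ) (x : Pt d) : ℝ := p * f x / mixture p f g x

variable {p : ℝ} {f g : Pt d → ℝ}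

lemma mixture_nonneg (hp : p ∈ Set.Ioo (0 : ℝ) 1) (hf : IsDensity f) (hg : IsDensity g)
    (x : Pt d) : 0 ≤ mixture p f g x :=
  add_nonneg (mul_nonneg hp.1.le (hf.nonneg x)) (mul_nonneg (sub_pos.2 hp.2).le (hg.nonneg x))

lemma measurable_mixture (hf : IsDensity f) (hg : IsDensity g) : Measurable (mixture p f g) :=
  (hf.measurable.const_mul p).add (hg.measurable.const_mul (1 - p))

lemma measurable_firstProb (hf : IsDensity f) (hg : IsDensity g) :
    Measurable (firstProb p f g) :=
  (hf.measurable.const_mul p).div (measurable_mixture hf hg)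

lemma firstProb_mem_Icc (hp : p ∈ Set.Ioo (0 : ℝ) 1) (hf : IsDensity f) (hg : IsDensity g)
    (x : Pt d) : firstProb p f g x ∈ Set.Icc (0 : ℝ) 1 :=
  ⟨div_nonneg (mul_nonneg hp.1.le (hf.nonneg x)) (mixture_nonneg hp hf hg x),
    div_le_one_of_le₀
      (le_add_of_nonneg_right (mul_nonneg (sub_pos.2 hp.2).le (hg.nonneg x)))
      (mixture_nonneg hp hf hg x)⟩

lemma isDensity_mixture (hp : p ∈ Set.Ioo (0 : ℝ) 1) (hf : IsDensity f) (hg : IsDensity g) :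
    IsDensity (mixture p f g) := by
  refine ⟨measurable_mixture hf hg, mixture_nonneg hp hf hg, ?_⟩
  have hq : 0 ≤ 1 - p := (sub_pos.2 hp.2).le
  have : ∀ x, ENNReal.ofReal (mixture p f g x) =
      ENNReal.ofReal p * ENNReal.ofReal (f x) + ENNReal.ofReal (1 - p) * ENNReal.ofReal (g x) := by
    intro x
    rw [mixture, ENNReal.ofReal_add (mul_nonneg hp.1.le (hf.nonneg x))
      (mul_nonneg hq (hg.nonneg x)),
      ENNReal.ofReal_mul hp.1.le, ENNReal.ofReal_mul hq]
  simp_rw [this]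
  rw [lintegral_add_left (hf.measurable.ennreal_ofReal.const_mul _),
    lintegral_const_mul _ hf.measurable.ennreal_ofReal,
    lintegral_const_mul _ hg.measurable.ennreal_ofReal, hf.lintegral_eq_one, hg.lintegral_eq_one,
    mul_one, mul_one, ← ENNReal.ofReal_add hp.1.le hq]
  simp

lemma law_eq_withDensity_firstProb (hp : p ∈ Set.Ioo (0 : ℝ) 1) (hf : IsDensity f)
    (hg : IsDensity g) :
    law f = (law (mixture p f g)).withDensity
      fun x => ENNReal.ofReal (firstProb p f g x / p) := by
  rw [law, law, ← withDensity_mul _ (measurable_mixture hf hg).ennreal_ofReal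
    ((measurable_firstProb hf hg).div_const p).ennreal_ofReal]
  congr 1
  ext x
  rw [Pi.mul_apply, ← ENNReal.ofReal_mul (mixture_nonneg hp hf hg x)]
  congr 1
  have hp0 := hp.1.ne'
  by_cases h : mixture p f g x = 0
  · have h1 := mul_nonneg hp.1.le (hf.nonneg x)
    have h2 := mul_nonneg (sub_pos.2 hp.2).le (hg.nonneg x)
    have h3 : p * f x = 0 := by rw [mixture] at h; linarith
    rw [h, zero_mul]
    simpa [hp0] using h3
  · rw [firstProb]; field_simp

lemma law_eq_withDensity_one_sub_firstProb (hp : p ∈ Set.Ioo (0 : ℝ) 1) (hf : IsDensity f)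
    (hg : IsDensity g) :
    law g = (law (mixture p f g)).withDensity
      fun x => ENNReal.ofReal ((1 - firstProb p f g x) / (1 - p)) := by
  have hmeas : Measurable fun x => (1 - firstProb p f g x) / (1 - p) :=
    ((measurable_firstProb hf hg).const_sub 1).div_const (1 - p)
  rw [law, law, ← withDensity_mul _ (measurable_mixture hf hg).ennreal_ofReal
    hmeas.ennreal_ofReal]
  congr 1
  ext x
  rw [Pi.mul_apply, ← ENNReal.ofReal_mul (mixture_nonneg hp hf hg x)]
  congr 1
  have hq : 1 - p ≠ 0 := (sub_pos.2 hp.2).ne'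
  by_cases h : mixture p f g x = 0
  · have h1 := mul_nonneg hp.1.le (hf.nonneg x)
    have h2 := mul_nonneg (sub_pos.2 hp.2).le (hg.nonneg x)
    have h3 : (1 - p) * g x = 0 := by rw [mixture] at h; linarith
    rw [h, zero_mul]
    simpa [hq] using h3
  · rw [firstProb]
    have e : 1 - p * f x / mixture p f g x = (1 - p) * g x / mixture p f g x := by
      rw [eq_div_iff h, sub_mul, div_mul_cancel₀ _ h, mixture]; ring
    rw [e]
    field_simp

/-- For different densities the limit `2 ∫ φ (1 - φ)` of `χ / t` is smaller than `2 p (1 - p)`: the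
difference is twice the variance of `φ`. -/
lemma integral_firstProb_mul_lt (hp : p ∈ Set.Ioo (0 : ℝ) 1) (hf : IsDensity f)
    (hg : IsDensity g) (hne : ¬ f =ᵐ[volume] g) :
    ∫ x, firstProb p f g x * (1 - firstProb p f g x) ∂law (mixture p f g) < p * (1 - p) := by
  set φ := firstProb p f g with hφ
  set μ := law (mixture p f g) with hμ
  have : IsProbabilityMeasure μ := (isDensity_mixture hp hf hg).isProbabilityMeasure
  have := hf.isProbabilityMeasure
  have hmeas : Measurable φ := measurable_firstProb hf hg
  have hmem : ∀ x, φ x ∈ Set.Icc (0 : ℝ) 1 := firstProb_mem_Icc hp hf hg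
  have hint : Integrable φ μ := Integrable.of_mem_Icc 0 1 hmeas.aemeasurable (ae_of_all _ hmem)
  have hint2 : Integrable (fun x => (φ x - p) ^ 2) μ := by
    refine Integrable.of_mem_Icc 0 1 ((hmeas.sub_const p).pow_const 2).aemeasurable
      (ae_of_all _ fun x => ⟨sq_nonneg _, ?_⟩)
    have := hmem x
    nlinarith [this.1, this.2, hp.1, hp.2]
  have hmean : ∫ x, φ x ∂μ = p := by
    have h1 : ∫⁻ x, ENNReal.ofReal (φ x / p) ∂μ = 1 := by
      have h2 : law f Set.univ = 1 := measure_univ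
      rw [law_eq_withDensity_firstProb hp hf hg, withDensity_apply _ MeasurableSet.univ,
        setLIntegral_univ] at h2
      exact h2
    have h3 : ∫ x, φ x / p ∂μ = 1 := by
      rw [integral_eq_lintegral_of_nonneg_ae
        (ae_of_all _ fun x => div_nonneg (hmem x).1 hp.1.le)
        (hmeas.div_const p).aestronglyMeasurable, h1]
      rfl
    rw [integral_div, div_eq_one_iff_eq hp.1.ne'] at h3
    exact h3
  have hid : ∫ x, φ x * (1 - φ x) ∂μ = p * (1 - p) - ∫ x, (φ x - p) ^ 2 ∂μ := by
    have e : ∀ x, φ x * (1 - φ x) = ((1 - 2 * p) * φ x + p ^ 2) - (φ x - p) ^ 2 := fun x => by ring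
    simp_rw [e]
    have i1 : Integrable (fun x => (1 - 2 * p) * φ x + p ^ 2) μ :=
      (hint.const_mul _).add (integrable_const _)
    rw [integral_sub i1 hint2,
      integral_add (hint.const_mul _) (integrable_const _), integral_const_mul, hmean,
      integral_const, probReal_univ, one_smul]
    ring
  rw [hid]
  refine sub_lt_self _ ?_
  refine (integral_nonneg fun x => sq_nonneg _).lt_of_ne' fun h0 => hne ?_
  rw [integral_eq_zero_iff_of_nonneg (fun x => sq_nonneg _) hint2] at h0
  have hae : ∀ᵐ x ∂μ, φ x = p := by
    filter_upwards [h0] with x hx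
    exact sub_eq_zero.1 (pow_eq_zero_iff two_ne_zero |>.1 hx)
  have e1 : law f = μ := by
    rw [law_eq_withDensity_firstProb hp hf hg]
    conv_rhs => rw [← withDensity_one (μ := μ)]
    refine withDensity_congr_ae ?_
    filter_upwards [hae] with x hx
    change ENNReal.ofReal (φ x / p) = 1
    rw [hx, div_self hp.1.ne', ENNReal.ofReal_one]
  have e2 : law g = μ := by
    rw [law_eq_withDensity_one_sub_firstProb hp hf hg]
    conv_rhs => rw [← withDensity_one (μ := μ)]
    refine withDensity_congr_ae ?_
    filter_upwards [hae] with x hx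
    change ENNReal.ofReal ((1 - φ x) / (1 - p)) = 1
    rw [hx, div_self (sub_pos.2 hp.2).ne', ENNReal.ofReal_one]
  have e3 := e1.trans e2.symm
  rw [law, law, withDensity_eq_iff hf.measurable.ennreal_ofReal.aemeasurable
    hg.measurable.ennreal_ofReal.aemeasurable (by rw [hf.lintegral_eq_one]; simp)] at e3
  filter_upwards [e3] with x hx
  exact (ENNReal.ofReal_eq_ofReal_iff (hf.nonneg x) (hg.nonneg x)).1 hx

/-- The density of the law of a labelled sample with respect to a sample from the mixture: up to a
constant, the conditional probability of the labels given the points. -/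
lemma labelLaw_eq_withDensity (hp : p ∈ Set.Ioo (0 : ℝ) 1) (hf : IsDensity f)
    (hg : IsDensity g) {m n : ℕ} {A : Finset (Fin (m + n))} (hA : A.card = m) :
    labelLaw f g A = (Measure.pi fun _ : Fin (m + n) => law (mixture p f g)).withDensity
      fun z => ENNReal.ofReal (labelWeight (fun k => firstProb p f g (z k)) Finset.univ A /
        (p ^ m * (1 - p) ^ n)) := by
  have := (isDensity_mixture hp hf hg).isProbabilityMeasure
  have hφ := measurable_firstProb (p := p) hf hg
  have hmem := firstProb_mem_Icc hp hf hg
  have hq : 0 < 1 - p := sub_pos.2 hp.2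
  have hp0 := hp.1
  set h : Fin (m + n) → Pt d → ℝ≥0∞ := fun k x =>
    ENNReal.ofReal (if k ∈ A then firstProb p f g x / p else (1 - firstProb p f g x) / (1 - p))
    with hh
  have hm : ∀ k, Measurable (h k) := by
    intro k
    refine Measurable.ennreal_ofReal ?_
    split_ifs
    exacts [hφ.div_const p, (measurable_const.sub hφ).div_const (1 - p)]
  have e : ∀ k, (if k ∈ A then law f else law g) = (law (mixture p f g)).withDensity (h k) := by
    intro k
    by_cases hk : k ∈ A
    · simp only [hk, if_true, hh]; exact law_eq_withDensity_firstProb hp hf hg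
    · simp only [hk, if_false, hh]; exact law_eq_withDensity_one_sub_firstProb hp hf hg
  have : ∀ k, SigmaFinite ((law (mixture p f g)).withDensity (h k)) := by
    intro k
    rw [← e k]
    have := isProbabilityMeasure_ite hf hg (k ∈ A)
    infer_instance
  rw [labelLaw]
  simp_rw [e]
  rw [pi_withDensity _ h hm]
  congr 1
  ext z
  rw [hh]
  simp only
  rw [← ENNReal.ofReal_prod_of_nonneg]
  · congr 1
    rw [labelWeight, mul_div_mul_comm, ← Finset.prod_sdiff (Finset.subset_univ A), mul_comm]
    congr 1
    · rw [Finset.prod_congr rfl fun k hk => if_pos hk, Finset.prod_div_distrib,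
        Finset.prod_const, hA]
    · rw [Finset.prod_congr rfl fun k hk => if_neg (Finset.mem_sdiff.1 hk).2,
        Finset.prod_div_distrib, Finset.prod_const, Finset.card_sdiff_of_subset
          (Finset.subset_univ A), hA, Finset.card_univ, Fintype.card_fin, Nat.add_sub_cancel_left]
  · intro k _
    split_ifs
    · exact div_nonneg (hmem _).1 hp0.le
    · exact div_nonneg (sub_nonneg.2 (hmem _).2) hq.le

end Mixture

/-! ### Consistency -/

section Consistency

open scoped ENNReal

variable {d : ℕ} {U : Type*} [MeasurableSpace U]

/-- The number of edges between distant points of a bounded region is bounded, whatever the number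
of points. -/
def MatchingRule.IsLocal (G : MatchingRule d U) : Prop :=
  ∀ (R ε : ℝ), 0 < ε → ∃ C : ℕ, ∀ (t : ℕ) (u : U) (z : Fin t → Pt d), Function.Injective z →
    (longEdges R ε z (G.perm t u z)).card ≤ C

/-- Under a local matching rule the values of a measurable function at matched points are close on
average. The function is approximated by a continuous function of compact support, and the error is
dominated by an additive functional of the points with small mean. -/
lemma exists_sum_sq_le (μ : Measure (Pt d)) [IsProbabilityMeasure μ]
    {G : MatchingRule d U} (hG : G.IsLocal) {φ : Pt d → ℝ} (hφ : Measurable φ)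
    (hmem : ∀ x, φ x ∈ Set.Icc (0 : ℝ) 1) {ε : ℝ} (hε : 0 < ε) :
    ∃ (h : Pt d → ℝ) (B : ℝ) (C : ℕ), Measurable h ∧ (∀ x, h x ∈ Set.Icc 0 B) ∧
      ∫ x, h x ∂μ ≤ ε ∧ ∀ (t : ℕ) (u : U) (z : Fin t → Pt d), Function.Injective z →
        ∑ k, (φ (z k) - φ (z (G.perm t u z k))) ^ 2 ≤ ∑ k, h (z k) + C := by
  have hint : Integrable φ μ := Integrable.of_mem_Icc 0 1 hφ.aemeasurable (ae_of_all _ hmem)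
  obtain ⟨ψ, hψc, hψ, hψcont, hψint⟩ :=
    hint.exists_hasCompactSupport_integral_sub_le (show 0 < ε / 6 by positivity)
  obtain ⟨δ, hδ, hδψ⟩ := Metric.uniformContinuous_iff.1
    (hψc.uniformContinuous_of_continuous hψcont) (ε / 3) (by positivity)
  obtain ⟨B, hB⟩ := hψcont.bounded_above_of_compact_support hψc
  obtain ⟨K, -, hK, hKμ⟩ := MeasurableSet.univ.exists_isCompact_sdiff_lt (μ := μ)
    (measure_ne_top μ _) (show ENNReal.ofReal (ε / 6) ≠ 0 by simpa using hε)
  obtain ⟨R, hR⟩ := hK.isBounded.subset_closedBall 0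
  obtain ⟨C, hC⟩ := hG R (δ / 2) (by positivity)
  set O : Set (Pt d) := {x | R < ‖x‖} with hO
  have hOm : MeasurableSet O := measurableSet_lt measurable_const measurable_norm
  have hOμ : μ.real O ≤ ε / 6 := by
    refine ENNReal.toReal_le_of_le_ofReal (by positivity) (le_trans (measure_mono ?_) hKμ.le)
    intro x hx
    refine ⟨Set.mem_univ x, fun hxK => ?_⟩
    have := mem_closedBall_zero_iff.1 (hR hxK)
    exact absurd hx (not_lt.2 this)
  set e : Pt d → ℝ := fun x => |φ x - ψ x| + O.indicator (fun _ => 1) x with he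
  have hem : Measurable e :=
    (hφ.sub hψcont.measurable).norm.add (measurable_const.indicator hOm)
  have he0 : ∀ x, 0 ≤ e x := fun x =>
    add_nonneg (abs_nonneg _) (Set.indicator_nonneg (fun _ _ => zero_le_one) x)
  have heB : ∀ x, e x ≤ 2 + B := by
    intro x
    have h1 : |φ x - ψ x| ≤ |φ x| + |ψ x| := abs_sub _ _
    have h2 : |φ x| ≤ 1 := abs_le.2 ⟨by linarith [(hmem x).1], (hmem x).2⟩
    have h3 : |ψ x| ≤ B := hB x
    have h4 : O.indicator (fun _ => (1 : ℝ)) x ≤ 1 :=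
      Set.indicator_le_self' (fun _ _ => zero_le_one) x
    simp only [he]
    linarith
  refine ⟨fun x => 2 * e x + ε / 3, 2 * (2 + B) + ε / 3, C, (hem.const_mul 2).add_const _,
    fun x => ⟨by linarith [he0 x], by linarith [heB x]⟩, ?_, ?_⟩
  · have i1 : Integrable (fun x => |φ x - ψ x|) μ := (hint.sub hψint).norm
    have i2 : Integrable (O.indicator fun _ => (1 : ℝ)) μ :=
      (integrable_const 1).indicator hOm
    have i3 : Integrable (fun x => 2 * e x) μ := (i1.add i2).const_mul 2
    rw [integral_add i3 (integrable_const _), integral_const_mul, integral_add i1 i2,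
      integral_indicator_const _ hOm, integral_const, probReal_univ, one_smul, smul_eq_mul, mul_one]
    have : ∫ x, |φ x - ψ x| ∂μ ≤ ε / 6 := hψ
    linarith
  · intro t u z hz
    set σ := G.perm t u z
    have key : ∀ k, (φ (z k) - φ (z (σ k))) ^ 2 ≤ e (z k) + e (z (σ k)) + ε / 3 +
        if k ∈ longEdges R (δ / 2) z σ then 1 else 0 := by
      intro k
      have a1 : |φ (z k) - φ (z (σ k))| ≤ 1 := by
        have h1 := hmem (z k)
        have h2 := hmem (z (σ k))
        exact abs_le.2 ⟨by linarith [h1.1, h2.2], by linarith [h1.2, h2.1]⟩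
      have a2 : (φ (z k) - φ (z (σ k))) ^ 2 ≤ |φ (z k) - φ (z (σ k))| := by
        rw [← sq_abs]; nlinarith [abs_nonneg (φ (z k) - φ (z (σ k)))]
      have e0 := he0 (z k)
      have e0' := he0 (z (σ k))
      by_cases hk : k ∈ longEdges R (δ / 2) z σ
      · rw [if_pos hk]; linarith
      rw [if_neg hk]
      have hout : ∀ x, x ∈ O → 1 ≤ e x := by
        intro x hx
        simp only [he, Set.indicator_of_mem hx]
        linarith [abs_nonneg (φ x - ψ x)]
      by_cases o1 : z k ∈ O
      · linarith [hout _ o1]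
      by_cases o2 : z (σ k) ∈ O
      · linarith [hout _ o2]
      rw [mem_longEdges] at hk
      have hd : ‖z k - z (σ k)‖ ≤ δ / 2 := by
        by_contra hlt
        exact hk ⟨not_lt.1 o1, not_lt.1 o2, not_le.1 hlt⟩
      have hψd : |ψ (z k) - ψ (z (σ k))| ≤ ε / 3 := by
        have := hδψ (a := z k) (b := z (σ k)) (by rw [dist_eq_norm]; linarith)
        rw [Real.dist_eq] at this
        exact this.le
      have t1 : |φ (z k) - φ (z (σ k))| ≤ |φ (z k) - ψ (z k)| + |ψ (z k) - ψ (z (σ k))| +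
          |φ (z (σ k)) - ψ (z (σ k))| := by
        have h1 := abs_sub_le (φ (z k)) (ψ (z k)) (φ (z (σ k)))
        have h2 := abs_sub_le (ψ (z k)) (ψ (z (σ k))) (φ (z (σ k)))
        rw [abs_sub_comm (ψ (z (σ k)))] at h2
        linarith
      have l1 : |φ (z k) - ψ (z k)| ≤ e (z k) :=
        le_add_of_nonneg_right (Set.indicator_nonneg (fun _ _ => zero_le_one) _)
      have l2 : |φ (z (σ k)) - ψ (z (σ k))| ≤ e (z (σ k)) :=
        le_add_of_nonneg_right (Set.indicator_nonneg (fun _ _ => zero_le_one) _)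
      linarith
    refine (Finset.sum_le_sum fun k _ => key k).trans ?_
    have hsum : ∑ k, (2 * e (z k) + ε / 3) = ∑ k, (e (z k) + e (z (σ k)) + ε / 3) := by
      rw [Finset.sum_add_distrib, Finset.sum_add_distrib,
        Finset.sum_add_distrib (f := fun k => e (z k)), Equiv.sum_comp σ fun k => e (z k),
        ← Finset.mul_sum, two_mul]
    rw [Finset.sum_add_distrib, hsum]
    have hcard : ∑ k, (if k ∈ longEdges R (δ / 2) z σ then (1 : ℝ) else 0) ≤ C := by
      rw [Finset.sum_ite_mem, Finset.univ_inter, Finset.sum_const, nsmul_eq_mul, mul_one]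
      exact_mod_cast hC t u z hz
    linarith

lemma lintegral_exp_le (μ : Measure (Pt d)) [IsProbabilityMeasure μ] {ψ : Pt d → ℝ}
    (hψ : Measurable ψ) {B r v : ℝ} (hB : ∀ x, ψ x ∈ Set.Icc 0 B) (hr : 0 ≤ r) (hrB : r * B ≤ 1)
    (hv : ∫ x, ψ x ∂μ ≤ v) :
    ∫⁻ x, ENNReal.ofReal (Real.exp (r * ψ x)) ∂μ ≤
      ENNReal.ofReal (Real.exp (r * v + (r * B) ^ 2)) := by
  have hint : Integrable ψ μ := Integrable.of_mem_Icc 0 B hψ.aemeasurable (ae_of_all _ hB)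
  have hpt : ∀ x, Real.exp (r * ψ x) ≤ r * ψ x + (1 + (r * B) ^ 2) := by
    intro x
    have h0 : 0 ≤ r * ψ x := mul_nonneg hr (hB x).1
    have h1 : r * ψ x ≤ r * B := mul_le_mul_of_nonneg_left (hB x).2 hr
    have h2 := (abs_le.1 (Real.abs_exp_sub_one_sub_id_le
      (abs_le.2 ⟨by linarith, h1.trans hrB⟩))).2
    have h3 : (r * ψ x) ^ 2 ≤ (r * B) ^ 2 := pow_le_pow_left₀ h0 h1 2
    linarith
  have hint2 : Integrable (fun x => r * ψ x + (1 + (r * B) ^ 2)) μ :=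
    (hint.const_mul r).add (integrable_const _)
  refine (lintegral_mono fun x => ENNReal.ofReal_le_ofReal (hpt x)).trans ?_
  rw [← ofReal_integral_eq_lintegral_ofReal hint2
    (ae_of_all _ fun x => (Real.exp_pos _).le.trans (hpt x))]
  refine ENNReal.ofReal_le_ofReal ?_
  rw [integral_add (hint.const_mul r) (integrable_const _), integral_const_mul, integral_const,
    probReal_univ, one_smul]
  have := Real.add_one_le_exp (r * v + (r * B) ^ 2)
  have := mul_le_mul_of_nonneg_left hv hr
  linarith

/-- A Chernoff bound for the upper tail of `χ`. The fixed sample sizes are replaced by independent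
labels of the points of a sample from the mixture, at the price of the binomial probability on the
left. -/
lemma choose_mul_sampleLaw_le (hd : 1 ≤ d) (κ : Measure U) [IsProbabilityMeasure κ]
    {G : MatchingRule d U} {p : ℝ} (hp : p ∈ Set.Ioo (0 : ℝ) 1) {f g : Pt d → ℝ}
    (hf : IsDensity f) (hg : IsDensity g) {h : Pt d → ℝ} (hh : Measurable h) {C : ℝ}
    (hC : ∀ (t : ℕ) (u : U) (z : Fin t → Pt d), Function.Injective z →
      ∑ k, (firstProb p f g (z k) - firstProb p f g (z (G.perm t u z k))) ^ 2 ≤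
        ∑ k, h (z k) + C) {m n : ℕ} (S : Set ℕ) {X : ℝ} (hS : ∀ x ∈ S, X ≤ (x : ℝ)) {r : ℝ}
    (hr : 0 ≤ r) (hr2 : r * 2 ≤ 1) :
    ENNReal.ofReal ((m + n).choose m * p ^ m * (1 - p) ^ n) *
        sampleLaw κ m n f g {w | chi m n (G.perm (m + n) w.1 (Fin.append w.2.1 w.2.2)) ∈ S} ≤
      ENNReal.ofReal (Real.exp (r * (C - X) + (m + n : ℕ) * (r * 2) ^ 2)) *
        (∫⁻ x, ENNReal.ofReal (Real.exp (r * (2 * (firstProb p f g x * (1 - firstProb p f g x)) +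
          h x))) ∂law (mixture p f g)) ^ (m + n) := by
  classical
  have := (isDensity_mixture hp hf hg).isProbabilityMeasure
  set N := m + n with hN
  set φ := firstProb p f g with hφdef
  have hφ : Measurable φ := measurable_firstProb hf hg
  have hmem : ∀ x, φ x ∈ Set.Icc (0 : ℝ) 1 := firstProb_mem_Icc hp hf hg
  set μ := law (mixture p f g) with hμ
  set ψ : Pt d → ℝ := fun x => 2 * (φ x * (1 - φ x)) + h x with hψ
  have hψm : Measurable ψ := ((hφ.mul (hφ.const_sub 1)).const_mul 2).add hh
  set P : Measure (Fin N → Pt d) := Measure.pi fun _ => μ with hP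
  have hp0 := hp.1
  have hq0 : 0 < 1 - p := sub_pos.2 hp.2
  have hc0 : 0 < p ^ m * (1 - p) ^ n := by positivity
  set T := (Finset.univ : Finset (Fin N)).powersetCard m with hT
  let E : Finset (Fin N) → Set (U × (Fin N → Pt d)) := fun A =>
    {w | crossCount A (G.perm N w.1 w.2) ∈ S}
  have hE : ∀ A, MeasurableSet (E A) := fun A => G.measurableSet_crossCount_mem N A S
  let W : Finset (Fin N) → U × (Fin N → Pt d) → ℝ := fun A w =>
    labelWeight (fun k => φ (w.2 k)) Finset.univ A
  have hWm : ∀ A, Measurable (W A) := by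
    intro A
    refine Measurable.mul ?_ ?_
    · exact Finset.measurable_prod _ fun k _ =>
        hφ.comp ((measurable_pi_apply k).comp measurable_snd)
    · exact Finset.measurable_prod _ fun k _ =>
        (hφ.comp ((measurable_pi_apply k).comp measurable_snd)).const_sub 1
  have hW0 : ∀ A w, 0 ≤ W A w := fun A w => labelWeight_nonneg (fun k => hmem _) _ _
  -- The probability of the event as an integral over a sample from the mixture, for each label set.
  have h1 : ∀ A ∈ T, ENNReal.ofReal (p ^ m * (1 - p) ^ n) *
      sampleLaw κ m n f g {w | chi m n (G.perm N w.1 (Fin.append w.2.1 w.2.2)) ∈ S} =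
      ∫⁻ w, (E A).indicator (fun w => ENNReal.ofReal (W A w)) w ∂κ.prod P := by
    intro A hA
    have hAm := (Finset.mem_powersetCard.1 hA).2
    have := isProbabilityMeasure_labelLaw hf hg A
    rw [sampleLaw_chi_mem hd κ G hf hg S hAm]
    have hdens := labelLaw_eq_withDensity hp hf hg hAm
    have hmz : Measurable fun z : Fin N → Pt d => ENNReal.ofReal
        (labelWeight (fun k => φ (z k)) Finset.univ A / (p ^ m * (1 - p) ^ n)) := by
      refine (Measurable.div_const (Measurable.mul ?_ ?_) _).ennreal_ofReal
      · exact Finset.measurable_prod _ fun k _ => hφ.comp (measurable_pi_apply k)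
      · exact Finset.measurable_prod _ fun k _ => (hφ.comp (measurable_pi_apply k)).const_sub 1
    have : SFinite (P.withDensity fun z => ENNReal.ofReal
        (labelWeight (fun k => φ (z k)) Finset.univ A / (p ^ m * (1 - p) ^ n))) := by
      rw [hP, hμ, ← hdens]; infer_instance
    rw [hdens, prod_withDensity_right hmz, withDensity_apply _ (hE A),
      ← lintegral_indicator (hE A), ← lintegral_const_mul']
    · refine lintegral_congr fun w => ?_
      by_cases hw : w ∈ E A
      · simp only [Set.indicator_of_mem hw]
        rw [← ENNReal.ofReal_mul hc0.le, mul_div_cancel₀ _ hc0.ne']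
      · simp only [Set.indicator_of_notMem hw, mul_zero]
    · exact ENNReal.ofReal_ne_top
  have h2 : ENNReal.ofReal (N.choose m * p ^ m * (1 - p) ^ n) *
      sampleLaw κ m n f g {w | chi m n (G.perm N w.1 (Fin.append w.2.1 w.2.2)) ∈ S} =
      ∫⁻ w, ∑ A ∈ T, (E A).indicator (fun w => ENNReal.ofReal (W A w)) w ∂κ.prod P := by
    rw [lintegral_finsetSum _ fun A _ => (hWm A).ennreal_ofReal.indicator (hE A),
      ← Finset.sum_congr rfl h1, Finset.sum_const, hT, Finset.card_powersetCard, Finset.card_univ,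
      Fintype.card_fin, nsmul_eq_mul, mul_assoc, ENNReal.ofReal_mul (by positivity),
      ENNReal.ofReal_natCast, mul_assoc]
  have hinj : ∀ᵐ w ∂κ.prod P, Function.Injective w.2 := by
    have := ae_injective_labelLaw (N := N) hd (isDensity_mixture hp hf hg)
      (isDensity_mixture hp hf hg) ∅
    simp only [labelLaw, Finset.notMem_empty, if_false] at this
    exact Measure.quasiMeasurePreserving_snd.ae this
  -- Markov's inequality and McDiarmid's inequality for the labels, given the points.
  have h3 : ∀ᵐ w ∂κ.prod P, ∑ A ∈ T, (E A).indicator (fun w => ENNReal.ofReal (W A w)) w ≤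
      ENNReal.ofReal (Real.exp (r * (C - X) + (N : ℝ) * (r * 2) ^ 2)) *
        ∏ k, ENNReal.ofReal (Real.exp (r * ψ (w.2 k))) := by
    filter_upwards [hinj] with w hw
    set σ := G.perm N w.1 w.2 with hσ
    have s1 : ∑ A ∈ T, (E A).indicator (fun w => ENNReal.ofReal (W A w)) w ≤
        ∑ A ∈ (Finset.univ : Finset (Fin N)).powerset,
          ENNReal.ofReal (W A w * Real.exp (r * crossCount A σ) * Real.exp (-(r * X))) := by
      refine (Finset.sum_le_sum fun A _ => ?_).trans
        (Finset.sum_le_sum_of_subset fun A hA =>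
          Finset.mem_powerset.2 (Finset.mem_powersetCard.1 hA).1)
      by_cases hA : w ∈ E A
      · rw [Set.indicator_of_mem hA]
        refine ENNReal.ofReal_le_ofReal ?_
        rw [mul_assoc, ← Real.exp_add]
        refine le_mul_of_one_le_right (hW0 A w) (Real.one_le_exp ?_)
        have : X ≤ (crossCount A σ : ℝ) := hS _ hA
        nlinarith
      · rw [Set.indicator_of_notMem hA]; exact zero_le
    refine s1.trans ?_
    rw [← ENNReal.ofReal_sum_of_nonneg (fun A _ => by have := hW0 A w; positivity),
      ← ENNReal.ofReal_prod_of_nonneg (fun k _ => (Real.exp_pos _).le), ← Real.exp_sum,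
      ← ENNReal.ofReal_mul (Real.exp_pos _).le, ← Real.exp_add, ← Finset.sum_mul]
    refine ENNReal.ofReal_le_ofReal ?_
    have m1 := labelMean_exp_le (a := fun k => φ (w.2 k)) (fun k => hmem _) hr hr2 Finset.univ
      (fun A => (crossCount A σ : ℝ)) (fun k A => abs_crossCount_insert_sub_le σ k A)
    have m2 := labelMean_crossCount_le (a := fun k => φ (w.2 k)) (fun k => hmem _) σ
    have m3 := hC N w.1 w.2 hw
    rw [Finset.card_univ, Fintype.card_fin] at m1
    refine (mul_le_mul_of_nonneg_right m1 (Real.exp_pos _).le).trans ?_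
    rw [← Real.exp_add, Real.exp_le_exp, ← Finset.mul_sum]
    have m4 : labelMean (fun k => φ (w.2 k)) Finset.univ (fun A => (crossCount A σ : ℝ)) ≤
        ∑ k, ψ (w.2 k) + C := by
      have : ∑ k, ψ (w.2 k) = ∑ k, 2 * (φ (w.2 k) * (1 - φ (w.2 k))) + ∑ k, h (w.2 k) := by
        rw [← Finset.sum_add_distrib]
      rw [this]; linarith
    have := mul_le_mul_of_nonneg_left m4 hr
    linarith
  rw [h2]
  refine (lintegral_mono_ae h3).trans ?_
  rw [lintegral_const_mul' _ _ ENNReal.ofReal_ne_top]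
  refine mul_le_mul_right (le_of_eq ?_) _
  have hF : ∀ k : Fin N, Measurable fun x => ENNReal.ofReal (Real.exp (r * ψ x)) := fun _ =>
    (hψm.const_mul r).exp.ennreal_ofReal
  have hprod : Measurable fun z : Fin N → Pt d =>
      ∏ k, ENNReal.ofReal (Real.exp (r * ψ (z k))) :=
    Finset.measurable_prod _ fun k _ => (hF k).comp (measurable_pi_apply k)
  have hsnd := (measurePreserving_snd (μ := κ) (ν := P)).lintegral_comp hprod
  rw [hsnd, hP, lintegral_pi_prod (fun _ => μ) _ hF, Finset.prod_const, Finset.card_univ,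
    Fintype.card_fin]

/-- A local matching rule gives a test that is consistent against every fixed alternative. -/
lemma tendsto_rejectProb (hd : 1 ≤ d) (κ : Measure U) [IsProbabilityMeasure κ]
    {G : MatchingRule d U} (hG : G.IsLocal) {p : ℝ} (hp : p ∈ Set.Ioo (0 : ℝ) 1)
    {m n : ℕ → ℕ} (hmn : ∀ t, m t + n t = t)
    (hm : Tendsto (fun t : ℕ => (m t : ℝ) / (t : ℝ)) atTop (𝓝 p))
    {η : ℕ → ℝ} (hη_zero : Tendsto η atTop (𝓝 0)) {f g : Pt d → ℝ}
    (hf : IsDensity f) (hg : IsDensity g) (hne : ¬ f =ᵐ[volume] g) :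
    Tendsto (fun t : ℕ => rejectProb κ G (m t) (n t) (2 * p * (1 - p) - η t) f g)
      atTop (𝓝 1) := by
  set φ := firstProb p f g with hφdef
  have hφ : Measurable φ := measurable_firstProb hf hg
  have hmem : ∀ x, φ x ∈ Set.Icc (0 : ℝ) 1 := firstProb_mem_Icc hp hf hg
  set μ := law (mixture p f g) with hμ
  have : IsProbabilityMeasure μ := (isDensity_mixture hp hf hg).isProbabilityMeasure
  set D := ∫ x, φ x * (1 - φ x) ∂μ with hD
  have hDlt : D < p * (1 - p) := integral_firstProb_mul_lt hp hf hg hne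
  set θ := p * (1 - p) - D with hθ
  have hθ0 : 0 < θ := sub_pos.2 hDlt
  obtain ⟨h, B, C, hh, hB, hhε, hC⟩ :=
    exists_sum_sq_le μ hG hφ hmem (show 0 < θ / 2 by positivity)
  have hB0 : 0 ≤ B := (hB 0).1.trans (hB 0).2
  set ψ : Pt d → ℝ := fun x => 2 * (φ x * (1 - φ x)) + h x with hψ
  have hψm : Measurable ψ := ((hφ.mul (hφ.const_sub 1)).const_mul 2).add hh
  have hψB : ∀ x, ψ x ∈ Set.Icc 0 (2 + B) := by
    intro x
    have h1 := hmem x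
    have h2 := hB x
    have h3 := mul_nonneg h1.1 (sub_nonneg.2 h1.2)
    simp only [hψ]
    exact ⟨by linarith [h2.1], by nlinarith [h2.2, h1.1, h1.2]⟩
  have hψint : ∫ x, ψ x ∂μ ≤ 2 * p * (1 - p) - 3 * θ / 2 := by
    have i1 : Integrable (fun x => 2 * (φ x * (1 - φ x))) μ := by
      refine Integrable.of_mem_Icc 0 2 ((hφ.mul (hφ.const_sub 1)).const_mul 2).aemeasurable
        (ae_of_all _ fun x => ?_)
      have h1 := hmem x
      have h3 := mul_nonneg h1.1 (sub_nonneg.2 h1.2)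
      exact ⟨by linarith, by nlinarith [h1.1, h1.2]⟩
    have i2 : Integrable h μ := Integrable.of_mem_Icc 0 B hh.aemeasurable (ae_of_all _ hB)
    rw [integral_add i1 i2, integral_const_mul, ← hD]
    linarith
  -- With this exponent the linear gain `r θ / 2` is at least twice the quadratic loss.
  obtain ⟨r, hr0, hr2, hrB, hrθ⟩ : ∃ r : ℝ, 0 < r ∧ r * 2 ≤ 1 ∧ r * (2 + B) ≤ 1 ∧
      r * (4 + (2 + B) ^ 2) ≤ θ / 4 := by
    have hB2 : 0 < 4 + (2 + B) ^ 2 := by positivity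
    refine ⟨min (1 / (2 + B)) (θ / 4 / (4 + (2 + B) ^ 2)), by positivity, ?_, ?_, ?_⟩
    · have h1 : min (1 / (2 + B)) (θ / 4 / (4 + (2 + B) ^ 2)) ≤ 1 / (2 + B) := min_le_left _ _
      rw [le_div_iff₀ (by positivity)] at h1
      have : 0 < min (1 / (2 + B)) (θ / 4 / (4 + (2 + B) ^ 2)) := by positivity
      nlinarith
    · exact (le_div_iff₀ (by positivity)).1 (min_le_left _ _)
    · exact (le_div_iff₀ hB2).1 (min_le_right _ _)
  set δ := r * θ / 8 with hδ
  have hδ0 : 0 < δ := by positivity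
  -- The probability of acceptance decays exponentially.
  have hacc : ∀ᶠ t : ℕ in atTop, 1 - rejectProb κ G (m t) (n t) (2 * p * (1 - p) - η t) f g ≤
      ENNReal.ofReal (Real.exp (r * C - δ * t)) := by
    filter_upwards [exp_neg_le_choose_mul hp hmn hm hδ0, hη_zero.eventually_lt_const hθ0,
      eventually_gt_atTop 0] with t hchoose hηt ht
    have ht0 : (0 : ℝ) < t := by exact_mod_cast ht
    have := isProbabilityMeasure_sampleLaw κ (m t) (n t) hf hg
    set c := 2 * p * (1 - p) - η t with hc
    let S : Set ℕ := {x | ¬ (x : ℝ) / ((m t + n t : ℕ) : ℝ) < c}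
    have hcompl : 1 - rejectProb κ G (m t) (n t) c f g = sampleLaw κ (m t) (n t) f g
        {w | chi (m t) (n t) (G.perm (m t + n t) w.1 (Fin.append w.2.1 w.2.2)) ∈ S} := by
      have h1 := measure_compl (μ := sampleLaw κ (m t) (n t) f g)
        (measurableSet_chi_mem G (m t) (n t) {x : ℕ | (x : ℝ) / ((m t + n t : ℕ) : ℝ) < c})
        (measure_ne_top _ _)
      rw [measure_univ] at h1
      exact h1.symm
    rw [hcompl]
    have hS : ∀ x ∈ S, (2 * p * (1 - p) - θ) * t ≤ (x : ℝ) := by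
      intro x hx
      have hx' : c ≤ (x : ℝ) / ((m t + n t : ℕ) : ℝ) := not_lt.1 hx
      rw [hmn t, le_div_iff₀ ht0] at hx'
      have : (2 * p * (1 - p) - θ) * t ≤ c * t := by
        refine mul_le_mul_of_nonneg_right ?_ ht0.le
        rw [hc]; linarith
      linarith
    have hmain := choose_mul_sampleLaw_le hd κ hp hf hg hh hC (m := m t) (n := n t) S hS hr0.le hr2
    have hexp := lintegral_exp_le μ hψm hψB hr0.le hrB hψint
    generalize sampleLaw κ (m t) (n t) f g
      {w | chi (m t) (n t) (G.perm (m t + n t) w.1 (Fin.append w.2.1 w.2.2)) ∈ S} = Q at hmain ⊢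
    rw [hmn t] at hmain
    have hlow : ENNReal.ofReal (Real.exp (-(δ * t))) * Q ≤
        ENNReal.ofReal (Real.exp (-(δ * t))) * ENNReal.ofReal (Real.exp (r * C - δ * t)) := by
      refine (mul_le_mul_left (ENNReal.ofReal_le_ofReal hchoose) _).trans (hmain.trans ?_)
      refine (mul_le_mul_right (pow_le_pow_left₀ zero_le hexp t) _).trans ?_
      rw [← ENNReal.ofReal_pow (Real.exp_pos _).le, ← ENNReal.ofReal_mul (Real.exp_pos _).le,
        ← ENNReal.ofReal_mul (Real.exp_pos _).le, ← Real.exp_nat_mul, ← Real.exp_add,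
        ← Real.exp_add]
      refine ENNReal.ofReal_le_ofReal (Real.exp_le_exp.2 ?_)
      have k1 := mul_le_mul_of_nonneg_left hrθ (mul_nonneg ht0.le hr0.le)
      rw [hδ]
      nlinarith
    exact (ENNReal.mul_le_mul_iff_right (by simpa using Real.exp_pos _)
      ENNReal.ofReal_ne_top).1 hlow
  have hlim : Tendsto (fun t : ℕ => ENNReal.ofReal (Real.exp (r * C - δ * t))) atTop (𝓝 0) := by
    have h1 : Tendsto (fun t : ℕ => r * C - δ * (t : ℝ)) atTop atBot :=
      tendsto_atBot_add_const_left _ _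
        (tendsto_neg_atTop_atBot.comp (tendsto_natCast_atTop_atTop.const_mul_atTop hδ0))
    have := ENNReal.tendsto_ofReal (Real.tendsto_exp_atBot.comp h1)
    simpa using this
  have h0 := tendsto_of_tendsto_of_tendsto_of_le_of_le' tendsto_const_nhds hlim
    (Eventually.of_forall fun _ => zero_le) hacc
  have h1 := ENNReal.Tendsto.sub (tendsto_const_nhds (x := (1 : ℝ≥0∞))) h0
    (Or.inl ENNReal.one_ne_top)
  rw [tsub_zero] at h1
  refine h1.congr fun t => ?_
  have := isProbabilityMeasure_sampleLaw κ (m t) (n t) hf hg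
  exact ENNReal.sub_sub_cancel ENNReal.one_ne_top prob_le_one

end Consistency

end CrossMatch

theorem corollary3 {d : ℕ} (hd : 1 ≤ d)
    {U : Type*} [MeasurableSpace U] (κ : Measure U) [IsProbabilityMeasure κ]
    (G : CrossMatch.MatchingRule d U)
    (p : ℝ) (hp : p ∈ Set.Ioo (0 : ℝ) 1)
    (m n : ℕ → ℕ) (hmn : ∀ t, m t + n t = t)
    (hm : Tendsto (fun t : ℕ => (m t : ℝ) / (t : ℝ)) atTop (𝓝 p))
    (η : ℕ → ℝ) (hη_zero : Tendsto η atTop (𝓝 0))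
    (hη_slow : Tendsto (fun t : ℕ => η t * Real.sqrt (t : ℝ)) atTop atTop) :
    -- optimal matchings
    (∀ (lam : ℝ → ℝ) (α : ℝ), MonotoneOn lam (Set.Ici 0) → α ∈ Set.Ioo (0 : ℝ) (d : ℝ) →
      lam =Θ[𝓝[>] (0 : ℝ)] (fun b : ℝ => b ^ α) →
      G.IsOptimal lam →
      -- asymptotic size 0
      ((∃ c : ℝ, c < 1 ∧ ∀ᶠ t : ℕ in atTop,
          2 * p * (1 - p) - 2 * ((m t : ℝ) / (t : ℝ)) * ((n t : ℝ) / (t : ℝ)) ≤ c * η t) →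
        Tendsto (fun t : ℕ => CrossMatch.size κ G (m t) (n t) (2 * p * (1 - p) - η t)
          {f | CrossMatch.IsDensity f}) atTop (𝓝 0)) ∧
      -- consistency against every fixed alternative
      (∀ f g : CrossMatch.Pt d → ℝ, CrossMatch.IsDensity f → CrossMatch.IsDensity g →
        ¬ f =ᵐ[volume] g →
        Tendsto (fun t : ℕ => CrossMatch.rejectProb κ G (m t) (n t) (2 * p * (1 - p) - η t) f g)
          atTop (𝓝 1))) ∧
    -- the greedy matching, for distributions with compact support
    (G.IsGreedy →
      ((∃ c : ℝ, c < 1 ∧ ∀ᶠ t : ℕ in atTop,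
          2 * p * (1 - p) - 2 * ((m t : ℝ) / (t : ℝ)) * ((n t : ℝ) / (t : ℝ)) ≤ c * η t) →
        Tendsto (fun t : ℕ => CrossMatch.size κ G (m t) (n t) (2 * p * (1 - p) - η t)
          {f | CrossMatch.IsDensity f ∧ CrossMatch.HasCompactLaw f}) atTop (𝓝 0)) ∧
      (∀ f g : CrossMatch.Pt d → ℝ, CrossMatch.IsDensity f → CrossMatch.IsDensity g →
        CrossMatch.HasCompactLaw f → CrossMatch.HasCompactLaw g →
        ¬ f =ᵐ[volume] g →
        Tendsto (fun t : ℕ => CrossMatch.rejectProb κ G (m t) (n t) (2 * p * (1 - p) - η t) f g)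
          atTop (𝓝 1))) := by
  refine ⟨fun lam α hmono hα hlam hG => ?_, fun hG => ?_⟩
  · have hmat : G.IsMatchingRule := fun t u z hz => (hG t u z hz).1
    have hloc : G.IsLocal := fun R ε hε => by
      obtain ⟨C, hC⟩ :=
        CrossMatch.IsOptimalMatching.exists_card_longEdges_le d hα.1 hmono hlam R hε
      exact ⟨C, fun t u z hz => hC t z _ (hG t u z hz)⟩
    exact ⟨fun hc => CrossMatch.tendsto_size hd κ hmat hmn hη_slow hc fun f hf => hf,
      fun f g hf hg hne => CrossMatch.tendsto_rejectProb hd κ hloc hp hmn hm hη_zero hf hg hne⟩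
  · have hmat : G.IsMatchingRule := fun t u z hz => (hG t u z hz).isMatching
    have hloc : G.IsLocal := fun R ε hε => by
      obtain ⟨C, hC⟩ := CrossMatch.IsGreedyMatching.exists_card_longEdges_le d R hε
      exact ⟨C, fun t u z hz => hC t z _ (hG t u z hz)⟩
    exact ⟨fun hc => CrossMatch.tendsto_size hd κ hmat hmn hη_slow hc fun f hf => hf.1,
      fun f g hf hg _ _ hne => CrossMatch.tendsto_rejectProb hd κ hloc hp hmn hm hη_zero hf hg hne⟩
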